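/- Let $r,s\ge 0$ be integers, let $\mathbb R^{r,s}$ be $\mathbb R^{r+s}$ with the scalar product $\langle\cdot,\cdot\rangle_{r,s}$ of the quadratic form $\sum_{i\le r}z_i^2-\sum_{j\le s}z_{r+j}^2$, and let $\mathrm{Cl}_{r,s}$ be the real Clifford algebra generated by $\mathbb R^{r,s}$ with $z^2=-\langle z,z\rangle_{r,s}$. Write $J_z$ for the action of $z\in\mathbb R^{r,s}$ on a Clifford module. An admissible scalar product on a Clifford module $U$ is a nondegenerate symmetric bilinear form with $\langle J_zx,y\rangle_U+\langle x,J_zy\rangle_U=0$ for all $z\in\mathbb R^{r,s}$ and $x,y\in U$. A minimal admissible module $V^{r,s}_{min}$ is a nonzero finite-dimensional module with an admissible scalar product, of the least possible dimension. Fix an orthonormal basis $z_1,\dots,z_{r+s}$ of $\mathbb R^{r,s}$ ($z_1,\dots,z_r$ positive, the others negative). Let $PI_{r,s}=\{P_1,\dots,P_p\}$ be a set, with the maximal possible number $p$ of elements, of mutually commuting (symmetric, isometric) involutions, each of one of the forms - $J_{z_{i_1}}J_{z_{i_2}}J_{z_{i_3}}J_{z_{i_4}}$ with four distinct basis vectors,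 an even number ($0$, $2$ or $4$) of them negative, - $J_{z_{i_1}}J_{z_{i_2}}J_{z_{i_3}}$ with three distinct basis vectors, an even number ($0$ or $2$) of them negative, such that no $P_k$ is, up to sign, a product of others as an element of $\mathrm{Cl}_{r,s}$. The common $1$-eigenspace $E_{r,s}\subset V^{r,s}_{min}$ is $$E_{r,s}=\{v: P_iv=v \text{ for all } i\le p\},$$ except that, if $r-s\equiv 3\pmod 4$ and $s$ is even, $$E_{r,s}=\{v: P_iv=v \text{ for all } i\le p-1\};$$ in this exceptional case $PI_{r,s}$ is chosen and ordered so that it contains at most one product of three maps $J_{z_i}$, and this one is $P_p$. **Theorem.** For every $V^{r,s}_{min}$, every admissible scalar product on it, and every such system $PI_{r,s}$, the space $E_{r,s}$ is nonzero, and the restriction of the admissible scalar product to $E_{r,s}$ is sign definite (positive definite or negative definite) if $r\equiv 0,1,2\pmod 4$ and $s\equiv 0\pmod 4$, or if $r\equiv 3\pmod 4$ and $s$ is arbitrary. In all other cases it is neutral, i.e. $E_{r,s}$ with the restricted form is isometric to $\mathbb R^{l,l}$ for some $l$. -/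

import Mathlib

open scoped BigOperators

universe u

noncomputable section

namespace PseudoHType

/-- The space `ℝ^{r,s}`; the left summand indexes the first `r` coordinates. -/
abbrev RS (r s : ℕ) : Type := Fin r ⊕ Fin s → ℝ

/-- The quadratic form `Q_{r,s}(z) = ∑_{i ≤ r} z_i² - ∑_{j ≤ s} z_{r+j}²`. -/
def Qrs (r s : ℕ) : QuadraticForm ℝ (RS r s) :=
  QuadraticMap.weightedSumSquares ℝ
    (Sum.elim (fun _ => (1 : ℝ)) (fun _ => (-1 : ℝ)) : Fin r ⊕ Fin s → ℝ)

/-- The scalar product `⟨x, y⟩_{r,s}`, the polarization of `Q_{r,s}`. -/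
def innerRS {r s : ℕ} (x y : RS r s) : ℝ := QuadraticMap.associated (Qrs r s) x y

/-- The Clifford algebra `Cl_{r,s}`, with relation `z ⊗ z = -⟨z, z⟩_{r,s}`.
(Mathlib's convention for `CliffordAlgebra Q` is `z ⊗ z = Q z`, hence the sign.) -/
abbrev Cl (r s : ℕ) : Type := CliffordAlgebra (-Qrs r s)

/-- The generator of `Cl_{r,s}` given by a vector `z`. -/
def gen {r s : ℕ} (z : RS r s) : Cl r s := CliffordAlgebra.ι (-Qrs r s) z

/-- An orthonormal basis of `ℝ^{r,s}`: the vectors with index in the left summand are positive,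
the others negative. -/
def IsOrthonormalBasis {r s : ℕ} (z : Module.Basis (Fin r ⊕ Fin s) ℝ (RS r s)) : Prop :=
  (∀ i j, i ≠ j → innerRS (z i) (z j) = 0) ∧
  (∀ i, innerRS (z (Sum.inl i)) (z (Sum.inl i)) = 1) ∧
  (∀ j, innerRS (z (Sum.inr j)) (z (Sum.inr j)) = -1)

/-! ### Admissible modules -/

section Modules

variable {r s : ℕ} {V : Type u} [AddCommGroup V] [Module ℝ V]

/-- `B` is an admissible scalar product for the Clifford module `(V, ρ)`: a nondegenerate
symmetric bilinear form for which every `J_z = ρ z` is skew-symmetric. -/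
structure IsAdmissible (ρ : Cl r s →ₐ[ℝ] Module.End ℝ V) (B : LinearMap.BilinForm ℝ V) :
    Prop where
  symm : ∀ x y, B x y = B y x
  nondegenerate : B.Nondegenerate
  skew : ∀ (z : RS r s) (x y : V), B (ρ (gen z) x) y + B x (ρ (gen z) y) = 0

/-- `(V, ρ, B)` is a minimal admissible module of `Cl_{r,s}`: a nonzero finite-dimensional
admissible module of the least possible dimension. (Every nonzero finite-dimensional real module
has a copy in each universe, so it is enough to compare with modules in the universe of `V`.) -/
structure IsMinimalAdmissible (ρ : Cl r s →ₐ[ℝ] Module.End ℝ V) (B : LinearMap.BilinForm ℝ V) :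
    Prop where
  finite : FiniteDimensional ℝ V
  nontrivial : Nontrivial V
  admissible : IsAdmissible ρ B
  minimal : ∀ (W : Type u) [AddCommGroup W] [Module ℝ W] [FiniteDimensional ℝ W] [Nontrivial W]
    (σ : Cl r s →ₐ[ℝ] Module.End ℝ W) (C : LinearMap.BilinForm ℝ W),
    IsAdmissible σ C → Module.finrank ℝ V ≤ Module.finrank ℝ W

end Modules

/-! ### Systems of involutions -/

section Involutions

variable {r s : ℕ}

/-- The Clifford monomial `z_{i_1} z_{i_2} ⋯ z_{i_k}` for the list `[i_1, …, i_k]`. -/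
def monomial (z : Module.Basis (Fin r ⊕ Fin s) ℝ (RS r s)) (l : List (Fin r ⊕ Fin s)) : Cl r s :=
  (l.map fun i => gen (z i)).prod

/-- The number of negative basis vectors in a monomial. -/
def negCount (l : List (Fin r ⊕ Fin s)) : ℕ := l.countP fun i => i.isRight

/-- Types `𝒫₁` (four distinct basis vectors, all positive or all negative) and
`𝒫₂` (four distinct basis vectors, two positive and two negative). -/
def IsQuadruple (z : Module.Basis (Fin r ⊕ Fin s) ℝ (RS r s)) (x : Cl r s) : Prop :=
  ∃ l : List (Fin r ⊕ Fin s), l.Nodup ∧ l.length = 4 ∧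
    (negCount l = 0 ∨ negCount l = 4 ∨ negCount l = 2) ∧ x = monomial z l

/-- Types `𝒫₃` (three distinct positive basis vectors) and
`𝒫₄` (three distinct basis vectors, one positive and two negative). -/
def IsTriple (z : Module.Basis (Fin r ⊕ Fin s) ℝ (RS r s)) (x : Cl r s) : Prop :=
  ∃ l : List (Fin r ⊕ Fin s), l.Nodup ∧ l.length = 3 ∧
    (negCount l = 0 ∨ negCount l = 2) ∧ x = monomial z l

/-- Mutually commuting elements `P_1, …, P_p` of the types `𝒫₁, 𝒫₂, 𝒫₃, 𝒫₄` such that none of them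
is, up to sign, a product of the others. The elements of these types act on every admissible module
as symmetric isometric involutions. As the system must serve all modules of `Cl_{r,s}`,
products are compared in the Clifford algebra itself. -/
structure IsInvolutionFamily (z : Module.Basis (Fin r ⊕ Fin s) ℝ (RS r s)) {p : ℕ}
    (P : Fin p → Cl r s) : Prop where
  type : ∀ k, IsQuadruple z (P k) ∨ IsTriple z (P k)
  comm : ∀ i j, P i * P j = P j * P i
  indep : ∀ k, P k ∉ Submonoid.closure (insert (-1) (P '' {j | j ≠ k}))

/-- The case `r - s ≡ 3 (mod 4)` with `s` even, in which the last involution only serves to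
distinguish the two minimal admissible modules. -/
def LastOmitted (r s : ℕ) : Prop := ((r : ℤ) - (s : ℤ)) % 4 = 3 ∧ Even s

/-- A system `PI_{r,s}`: an involution family with the maximal number of members. When the last
member plays its special role, the system is ordered so that at most one member has type `𝒫₃` or
`𝒫₄`, and it is the last one. -/
structure IsPI (z : Module.Basis (Fin r ⊕ Fin s) ℝ (RS r s)) {p : ℕ}
    (P : Fin p → Cl r s) : Prop where
  family : IsInvolutionFamily z P
  maximal : ∀ (q : ℕ) (P' : Fin q → Cl r s), IsInvolutionFamily z P' → q ≤ p
  ordered : LastOmitted r s → ∀ k : Fin p, IsTriple z (P k) → (k : ℕ) + 1 = p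

/-- The common 1-eigenspace `E_{r,s}`: the vectors fixed by all `P_i`, `i ≤ p`, or, if
`r - s ≡ 3 (mod 4)` and `s` is even, by all `P_i`, `i ≤ p - 1`. -/
def commonEigenspace {V : Type u} [AddCommGroup V] [Module ℝ V]
    (ρ : Cl r s →ₐ[ℝ] Module.End ℝ V) {p : ℕ} (P : Fin p → Cl r s) : Submodule ℝ V :=
  ⨅ (k : Fin p) (_ : LastOmitted r s → (k : ℕ) + 1 < p), Module.End.eigenspace (ρ (P k)) 1

end Involutions

/-! ### Signature of the restricted scalar product -/

section Signature

variable {V : Type u} [AddCommGroup V] [Module ℝ V]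

/-- The quadratic form `v ↦ B(v, v)` on a subspace `E`. -/
def restrictedForm (B : LinearMap.BilinForm ℝ V) (E : Submodule ℝ V) : QuadraticForm ℝ E :=
  (B.restrict E).toQuadraticMap

/-- The restriction of `B` to `E` is positive definite or negative definite. -/
def IsSignDefiniteOn (B : LinearMap.BilinForm ℝ V) (E : Submodule ℝ V) : Prop :=
  (restrictedForm B E).PosDef ∨ (-restrictedForm B E).PosDef

/-- `E` with the restriction of `B` is isometric to `ℝ^{l,l}` for some `l`. -/
def IsNeutralOn (B : LinearMap.BilinForm ℝ V) (E : Submodule ℝ V) : Prop :=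
  ∃ l : ℕ, (restrictedForm B E).Equivalent (Qrs l l)

end Signature

end PseudoHType

end

/-! Up to sign a Clifford monomial is a word over `ZMod 2`: products become sums of words, and
`commForm` decides whether two monomials commute or anticommute. A monomial is symmetric when its
weight is 0 or 3 modulo 4; it is an isometry when it has an even number of negative letters and an
anti-isometry otherwise. A system of involutions thus spans a totally singular space of words.

A Witt-type dimension count (`MaximalSingular.finrank_le`) bounds every totally singular space by
any maximal one. Some maximal one is spanned by words of weight three and four
(`hasShortMaximal_negMark`), so a system with the largest number of members spans a maximal singular
space M (`IsPI.exists_isWordSystem`).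

Everything then depends on whether the parity of negative letters equals `commForm g` for some g in
M. Only the word of all negative letters and that of all positive letters are candidates, and one of
them succeeds exactly when s ≡ 0 or r ≡ 3 modulo 4. If none does, duality gives a monomial that
commutes with all the involutions and reverses the form, so E is isometric to its negative, hence
neutral. If one does, every monomial commuting with the involutions is an isometry. For v in E with
B(v,v) ≠ 0 the operator `frame` then multiplies v by a nonzero scalar, hence acts by that scalar on
the submodule generated by v. This submodule is nondegenerate and, by minimality, is all of V.
Pairing with u in E turns a positive multiple of B(v,v)B(u,u) into a sum of squares.

In the exceptional case M contains the central volume word. Dropping the last involution removes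
that word from the span, which keeps E nonzero; minimality makes it act as a scalar, so all of M
still acts on E by signs. -/

noncomputable section

namespace PseudoHType

/-! ### Binary words -/

section Words

variable {ι κ : Type} [Fintype ι] [Fintype κ]

/-- The number of nonzero letters of a binary word. -/
def weight (x : ι → ZMod 2) : ℕ := ∑ i, (x i).val

lemma zmod_two_cases (a : ZMod 2) : a = 0 ∨ a = 1 := by
  revert a; decide

lemma weight_add (x y : ι → ZMod 2) :
    weight (x + y) + 2 * weight (x * y) = weight x + weight y := by
  have h : ∀ a b : ZMod 2, (a + b).val + 2 * (a * b).val = a.val + b.val := by decide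
  simp only [weight, Finset.mul_sum, ← Finset.sum_add_distrib, Pi.add_apply, Pi.mul_apply, h]

lemma natCast_weight (x : ι → ZMod 2) : (weight x : ZMod 2) = ∑ i, x i := by
  simp [weight]

/-- The alternating form that records which Clifford monomials anticommute. -/
def commForm : LinearMap.BilinForm (ZMod 2) (ι → ZMod 2) :=
  LinearMap.mk₂ (ZMod 2) (fun x y => (∑ i, x i) * (∑ i, y i) + ∑ i, x i * y i)
    (fun x y w => by simp only [Pi.add_apply, add_mul, Finset.sum_add_distrib]; ring)
    (fun c x y => by
      simp only [Pi.smul_apply, smul_eq_mul, mul_assoc, ← Finset.mul_sum]; ring)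
    (fun x y w => by simp only [Pi.add_apply, mul_add, Finset.sum_add_distrib]; ring)
    (fun c x y => by
      simp only [Pi.smul_apply, smul_eq_mul, mul_left_comm _ c, ← Finset.mul_sum]; ring)

lemma commForm_apply (x y : ι → ZMod 2) :
    commForm x y = (∑ i, x i) * (∑ i, y i) + ∑ i, x i * y i := rfl

lemma commForm_eq_weight (x y : ι → ZMod 2) :
    commForm x y = ((weight x * weight y + weight (x * y) : ℕ) : ZMod 2) := by
  push_cast
  simp only [natCast_weight, commForm_apply, Pi.mul_apply]

lemma commForm_comm (x y : ι → ZMod 2) : commForm x y = commForm y x := by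
  simp only [commForm_apply, mul_comm]

/-- The number, modulo two, of letters of `x` at the places marked by `ν`. -/
def parity (ν : ι → ZMod 2) : Module.Dual (ZMod 2) (ι → ZMod 2) where
  toFun x := ∑ i, ν i * x i
  map_add' x y := by simp only [Pi.add_apply, mul_add, Finset.sum_add_distrib]
  map_smul' c x := by
    simp only [Pi.smul_apply, smul_eq_mul, mul_left_comm _ c, ← Finset.mul_sum, RingHom.id_apply]

lemma parity_apply (ν x : ι → ZMod 2) : parity ν x = ∑ i, ν i * x i := rfl

/-- The words of symmetric monomials with an even number of letters marked by `ν`. -/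
def IsSingular (ν x : ι → ZMod 2) : Prop :=
  (weight x % 4 = 0 ∨ weight x % 4 = 3) ∧ parity ν x = 0

lemma IsSingular.zero (ν : ι → ZMod 2) : IsSingular ν 0 := by
  simp [IsSingular, weight]

/-- The word counterpart of the fact that commuting symmetric operators have a symmetric product. By
`weight_add` the weight changes by twice the overlap, and commuting fixes the parity of the overlap:
odd exactly when both weights are odd. -/
lemma IsSingular.add {ν x y : ι → ZMod 2} (hx : IsSingular ν x) (hy : IsSingular ν y)
    (h : commForm x y = 0) : IsSingular ν (x + y) := by
  refine ⟨?_, by rw [map_add, hx.2, hy.2, add_zero]⟩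
  have h1 := weight_add x y
  rw [commForm_eq_weight, ZMod.natCast_eq_zero_iff_even, Nat.even_iff, Nat.add_mod,
    Nat.mul_mod] at h
  rcases hx.1 with a | a <;> rcases hy.1 with b | b
  · have a' : weight x % 2 = 0 := by omega
    rw [a'] at h; simp at h; omega
  · have a' : weight x % 2 = 0 := by omega
    rw [a'] at h; simp at h; omega
  · have a' : weight y % 2 = 0 := by omega
    rw [a'] at h; simp at h; omega
  · have a' : weight x % 2 = 1 := by omega
    have b' : weight y % 2 = 1 := by omega
    rw [a', b'] at h; omega

/-- A space of pairwise commuting singular words. -/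
structure TotallySingular (ν : ι → ZMod 2) (M : Submodule (ZMod 2) (ι → ZMod 2)) : Prop where
  singular : ∀ x ∈ M, IsSingular ν x
  isotropic : ∀ x ∈ M, ∀ y ∈ M, commForm x y = 0

lemma commForm_eq_zero_of_mem_span {X : Set (ι → ZMod 2)} {y : ι → ZMod 2}
    (h : ∀ x ∈ X, commForm x y = 0) {x : ι → ZMod 2} (hx : x ∈ Submodule.span (ZMod 2) X) :
    commForm x y = 0 := by
  induction hx using Submodule.span_induction with
  | mem x hx => exact h x hx
  | zero => simp
  | add a b _ _ ha hb => simp [ha, hb]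
  | smul c a _ ha => simp [ha]

lemma totallySingular_span {ν : ι → ZMod 2} {X : Set (ι → ZMod 2)}
    (h : ∀ x ∈ X, IsSingular ν x) (hX : ∀ x ∈ X, ∀ y ∈ X, commForm x y = 0) :
    TotallySingular ν (Submodule.span (ZMod 2) X) := by
  have iso : ∀ x ∈ Submodule.span (ZMod 2) X, ∀ y ∈ Submodule.span (ZMod 2) X,
      commForm x y = 0 := by
    intro x hx y hy
    refine commForm_eq_zero_of_mem_span (fun a ha => ?_) hx
    rw [commForm_comm]
    exact commForm_eq_zero_of_mem_span (fun b hb => hX b hb a ha) hy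
  refine ⟨fun x hx => ?_, iso⟩
  induction hx using Submodule.span_induction with
  | mem x hx => exact h x hx
  | zero => exact IsSingular.zero ν
  | add a b ha hb h1 h2 => exact h1.add h2 (iso a ha b hb)
  | smul c a _ ha =>
    rcases zmod_two_cases c with rfl | rfl
    · rw [zero_smul]; exact IsSingular.zero ν
    · rwa [one_smul]

/-- A totally singular space that contains all singular words commuting with it. -/
structure MaximalSingular (ν : ι → ZMod 2) (M : Submodule (ZMod 2) (ι → ZMod 2)) : Prop
    extends TotallySingular ν M where
  mem : ∀ y, IsSingular ν y → (∀ x ∈ M, commForm x y = 0) → y ∈ M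

/-- Witt's argument: pair `M'` with `M` by `commForm`. By maximality the kernel in `M'` lies in the
intersection `N`, while the image annihilates `N`, so the dimensions of kernel and image add up to
at most that of `M`. -/
lemma MaximalSingular.finrank_le {ν : ι → ZMod 2} {M M' : Submodule (ZMod 2) (ι → ZMod 2)}
    (hM : MaximalSingular ν M) (hM' : TotallySingular ν M') :
    Module.finrank (ZMod 2) M' ≤ Module.finrank (ZMod 2) M := by
  let f : M' →ₗ[ZMod 2] Module.Dual (ZMod 2) M :=
    (commForm (ι := ι)).compl₁₂ M'.subtype M.subtype
  have hf : ∀ a b, f a b = commForm (a : ι → ZMod 2) (b : ι → ZMod 2) := fun a b => rfl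
  let N : Submodule (ZMod 2) M := M'.comap M.subtype
  have hker : Module.finrank (ZMod 2) (LinearMap.ker f) ≤ Module.finrank (ZMod 2) N := by
    have hmem : ∀ a : LinearMap.ker f, ((a : M') : ι → ZMod 2) ∈ M := by
      intro a
      refine hM.mem _ (hM'.singular _ a.1.2) fun x hx => ?_
      rw [commForm_comm, ← hf a.1 ⟨x, hx⟩, LinearMap.mem_ker.1 a.2]; rfl
    let g : LinearMap.ker f →ₗ[ZMod 2] N :=
      ((M'.subtype ∘ₗ (LinearMap.ker f).subtype).codRestrict M hmem).codRestrict N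
        (fun a => a.1.2)
    refine LinearMap.finrank_le_finrank_of_injective (f := g) fun a b hab => ?_
    have := congrArg (fun t : N => ((t : M) : ι → ZMod 2)) hab
    exact Subtype.ext (Subtype.ext this)
  have hrange : LinearMap.range f ≤ N.dualAnnihilator := by
    rintro _ ⟨a, rfl⟩
    rw [Submodule.mem_dualAnnihilator]
    intro b hb
    rw [hf]
    exact hM'.isotropic _ a.2 _ hb
  have h1 := Submodule.finrank_mono hrange
  have h2 := Subspace.finrank_add_finrank_dualAnnihilator_eq N
  have h3 := LinearMap.finrank_range_add_finrank_ker f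
  omega

/-! ### Maximal totally singular spaces spanned by words of weight three and four -/

/-- A maximal totally singular space can be spanned by words of weight three and four. -/
def HasShortMaximal (ν : ι → ZMod 2) : Prop :=
  ∃ X : Set (ι → ZMod 2), (∀ x ∈ X, (weight x = 3 ∨ weight x = 4) ∧ parity ν x = 0) ∧
    (∀ x ∈ X, ∀ y ∈ X, commForm x y = 0) ∧
    ∀ y, IsSingular ν y → (∀ x ∈ X, commForm x y = 0) → y ∈ Submodule.span (ZMod 2) X

lemma weight_comp_equiv (e : ι ≃ κ) (x : κ → ZMod 2) : weight (x ∘ e) = weight x :=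
  Equiv.sum_comp e fun i => (x i).val

lemma commForm_comp_equiv (e : ι ≃ κ) (x y : κ → ZMod 2) :
    commForm (x ∘ e) (y ∘ e) = commForm x y := by
  simp only [commForm_apply, Function.comp_apply, Equiv.sum_comp e x, Equiv.sum_comp e y,
    Equiv.sum_comp e fun i => x i * y i]

lemma parity_comp_equiv (e : ι ≃ κ) (ν x : κ → ZMod 2) :
    parity (ν ∘ e) (x ∘ e) = parity ν x := by
  simp only [parity_apply, Function.comp_apply, Equiv.sum_comp e fun i => ν i * x i]

lemma HasShortMaximal.comp_equiv {ν : κ → ZMod 2} (h : HasShortMaximal ν) (e : ι ≃ κ) :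
    HasShortMaximal (ν ∘ e) := by
  obtain ⟨X, h1, h2, h3⟩ := h
  refine ⟨(fun x => x ∘ e) '' X, ?_, ?_, ?_⟩
  · rintro _ ⟨x, hx, rfl⟩
    rw [weight_comp_equiv, parity_comp_equiv]
    exact h1 x hx
  · rintro _ ⟨x, hx, rfl⟩ _ ⟨y, hy, rfl⟩
    rw [commForm_comp_equiv]
    exact h2 x hx y hy
  · intro y hy hX
    obtain ⟨y, rfl⟩ : ∃ y', y = y' ∘ e := ⟨y ∘ e.symm, by ext; simp⟩
    rw [IsSingular, weight_comp_equiv, parity_comp_equiv] at hy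
    have := h3 y hy fun x hx => by
      rw [← commForm_comp_equiv e]
      exact hX _ ⟨x, hx, rfl⟩
    have h4 := Submodule.mem_map_of_mem (f := LinearMap.funLeft (ZMod 2) (ZMod 2) e) this
    rw [Submodule.map_span] at h4
    exact h4

lemma weight_sumElim (x : ι → ZMod 2) (y : κ → ZMod 2) :
    weight (Sum.elim x y) = weight x + weight y := by
  simp [weight]

lemma commForm_sumElim (x x' : ι → ZMod 2) (y y' : κ → ZMod 2) :
    commForm (Sum.elim x y) (Sum.elim x' y') =
      commForm x x' + commForm y y' + (∑ i, x i) * (∑ i, y' i) + (∑ i, y i) * (∑ i, x' i) := by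
  simp only [commForm_apply, Fintype.sum_sum_type, Sum.elim_inl, Sum.elim_inr]
  ring

lemma parity_sumElim (ν x : ι → ZMod 2) (μ y : κ → ZMod 2) :
    parity (Sum.elim ν μ) (Sum.elim x y) = parity ν x + parity μ y := by
  simp [parity_apply]

/-- A self-dual block of words of weight four may be added. -/
lemma HasShortMaximal.sumElim {ν : ι → ZMod 2} (h : HasShortMaximal ν) {μ : κ → ZMod 2}
    {Y : Set (κ → ZMod 2)} (hY : ∀ y ∈ Y, weight y = 4 ∧ parity μ y = 0)
    (hYY : ∀ x ∈ Y, ∀ y ∈ Y, commForm x y = 0)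
    (hdual : ∀ y, (∀ x ∈ Y, commForm x y = 0) → y ∈ Submodule.span (ZMod 2) Y) :
    HasShortMaximal (Sum.elim ν μ) := by
  obtain ⟨X, h1, h2, h3⟩ := h
  let L : (ι → ZMod 2) →ₗ[ZMod 2] (ι ⊕ κ → ZMod 2) :=
    { toFun := fun x => Sum.elim x (0 : κ → ZMod 2)
      map_add' := fun x y => by ext (i | i) <;> simp
      map_smul' := fun c x => by ext (i | i) <;> simp }
  let R : (κ → ZMod 2) →ₗ[ZMod 2] (ι ⊕ κ → ZMod 2) :=
    { toFun := fun x => Sum.elim (0 : ι → ZMod 2) x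
      map_add' := fun x y => by ext (i | i) <;> simp
      map_smul' := fun c x => by ext (i | i) <;> simp }
  have hL : ∀ x, L x = Sum.elim x (0 : κ → ZMod 2) := fun x => rfl
  have hR : ∀ x, R x = Sum.elim (0 : ι → ZMod 2) x := fun x => rfl
  have even : ∀ y ∈ Y, ∑ i, y i = 0 := by
    intro y hy
    rw [← natCast_weight, (hY y hy).1]; rfl
  have w0 : weight (0 : κ → ZMod 2) = 0 := by simp [weight]
  have w0' : weight (0 : ι → ZMod 2) = 0 := by simp [weight]
  have hsing : ∀ y ∈ Submodule.span (ZMod 2) Y, IsSingular μ y :=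
    (totallySingular_span (fun y hy => ⟨Or.inl (by rw [(hY y hy).1]), (hY y hy).2⟩) hYY).singular
  refine ⟨L '' X ∪ R '' Y, ?_, ?_, ?_⟩
  · rintro _ (⟨x, hx, rfl⟩ | ⟨x, hx, rfl⟩)
    · rw [hL, weight_sumElim, parity_sumElim, w0, map_zero, add_zero, add_zero]
      exact h1 x hx
    · rw [hR, weight_sumElim, parity_sumElim, w0', map_zero, zero_add, zero_add]
      exact ⟨Or.inr (hY x hx).1, (hY x hx).2⟩
  · rintro _ (⟨x, hx, rfl⟩ | ⟨x, hx, rfl⟩) _ (⟨y, hy, rfl⟩ | ⟨y, hy, rfl⟩)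
    · simp [hL, commForm_sumElim, h2 x hx y hy]
    · simp [hL, hR, commForm_sumElim, even y hy]
    · simp [hL, hR, commForm_sumElim, even x hx]
    · simp [hR, commForm_sumElim, hYY x hx y hy]
  · intro k hk hX
    obtain ⟨x, y, rfl⟩ : ∃ (x : ι → ZMod 2) (y : κ → ZMod 2), k = Sum.elim x y :=
      ⟨k ∘ Sum.inl, k ∘ Sum.inr, by ext (i | i) <;> rfl⟩
    have hy : y ∈ Submodule.span (ZMod 2) Y := by
      refine hdual y fun b hb => ?_
      have := hX _ (Or.inr ⟨b, hb, rfl⟩)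
      simpa [hR, commForm_sumElim, even b hb] using this
    have ev : ∑ i, y i = 0 := by
      clear hX hk
      induction hy using Submodule.span_induction with
      | mem b hb => exact even b hb
      | zero => simp
      | add a b _ _ ha hb => simp [Finset.sum_add_distrib, ha, hb]
      | smul c a _ ha => simp [← Finset.mul_sum, ha]
    have hs := hsing y hy
    -- The block component is now itself singular of even weight, so discarding it changes neither
    -- the singularity nor the commutation of the other component.
    have hx : x ∈ Submodule.span (ZMod 2) X := by
      refine h3 x ⟨?_, ?_⟩ fun a ha => ?_
      · have hw := hk.1
        rw [weight_sumElim] at hw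
        have e2 : weight y % 2 = 0 := by
          rw [← natCast_weight, ZMod.natCast_eq_zero_iff_even, Nat.even_iff] at ev
          exact ev
        have := hs.1
        omega
      · have := hk.2
        rwa [parity_sumElim, hs.2, add_zero] at this
      · have := hX _ (Or.inl ⟨a, ha, rfl⟩)
        simpa [hL, commForm_sumElim, ev] using this
    have : Sum.elim x y = L x + R y := by ext (i | i) <;> simp [hL, hR]
    rw [this, Submodule.span_union]
    refine Submodule.add_mem_sup ?_ ?_
    · rw [← Submodule.map_span]; exact Submodule.mem_map_of_mem hx
    · rw [← Submodule.map_span]; exact Submodule.mem_map_of_mem hy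

end Words

/-! ### Words encoded by natural numbers -/

section Bits

/-- The word of length `n` formed by the binary digits of `k`. -/
def bitWord (n k : ℕ) : Fin n → ZMod 2 := fun i => if k.testBit i then 1 else 0

/-- The number of nonzero digits among the last `n` binary digits of `k`. -/
def bitCount : ℕ → ℕ → ℕ
  | 0, _ => 0
  | n + 1, k => k % 2 + bitCount n (k / 2)

lemma weight_bitWord (n k : ℕ) : weight (bitWord n k) = bitCount n k := by
  induction n generalizing k with
  | zero => simp [weight, bitCount]
  | succ n ih =>
    rw [bitCount, ← ih (k / 2), weight, Fin.sum_univ_succ]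
    congr 1
    · rcases Nat.mod_two_eq_zero_or_one k with h | h <;> simp [bitWord, h]
      rfl
    · simp [weight, bitWord, Nat.testBit_succ]

lemma bitWord_mul (n k l : ℕ) : bitWord n k * bitWord n l = bitWord n (k &&& l) := by
  ext i
  by_cases h : k.testBit i <;> by_cases h' : l.testBit i <;> simp [bitWord, h, h']

lemma bitWord_add (n k l : ℕ) : bitWord n k + bitWord n l = bitWord n (k ^^^ l) := by
  ext i
  by_cases h : k.testBit i <;> by_cases h' : l.testBit i <;> simp [bitWord, h, h']
  rfl

lemma exists_bitWord {n : ℕ} (x : Fin n → ZMod 2) : ∃ k < 2 ^ n, bitWord n k = x := by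
  refine ⟨Nat.ofBits fun i => decide (x i = 1), Nat.ofBits_lt_two_pow _, ?_⟩
  ext i
  rcases zmod_two_cases (x i) with h | h <;> simp [bitWord, h]

/-- Commutation of words, computed from their codes. -/
def bitCommute (n k l : ℕ) : Bool :=
  (bitCount n k * bitCount n l + bitCount n (k &&& l)) % 2 == 0

lemma bitCommute_iff (n k l : ℕ) :
    bitCommute n k l = true ↔ commForm (bitWord n k) (bitWord n l) = 0 := by
  rw [commForm_eq_weight, ZMod.natCast_eq_zero_iff_even, bitWord_mul, weight_bitWord,
    weight_bitWord, weight_bitWord, bitCommute, Nat.even_iff, beq_iff_eq]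

/-- The parity of a word, computed from its code. -/
def bitParity (n m k : ℕ) : Bool := bitCount n (m &&& k) % 2 == 0

lemma bitParity_iff (n m k : ℕ) :
    bitParity n m k = true ↔ parity (bitWord n m) (bitWord n k) = 0 := by
  have : parity (bitWord n m) (bitWord n k) = ((bitCount n (m &&& k) : ℕ) : ZMod 2) := by
    rw [← weight_bitWord, ← bitWord_mul, natCast_weight]; rfl
  rw [this, ZMod.natCast_eq_zero_iff_even, bitParity, Nat.even_iff, beq_iff_eq]

/-- All sums of the words with codes in a list. -/
def bitSpan : List ℕ → List ℕ
  | [] => [0]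
  | x :: l => bitSpan l ++ (bitSpan l).map (x ^^^ ·)

lemma bitWord_mem_span {n : ℕ} {X : List ℕ} {k : ℕ} (h : k ∈ bitSpan X) :
    bitWord n k ∈ Submodule.span (ZMod 2) (bitWord n '' {x | x ∈ X}) := by
  induction X generalizing k with
  | nil =>
    obtain rfl : k = 0 := by simpa [bitSpan] using h
    have : bitWord n 0 = 0 := by ext; simp [bitWord]
    rw [this]; exact zero_mem _
  | cons x l ih =>
    have hs : bitWord n '' {y | y ∈ l} ⊆ bitWord n '' {y | y ∈ x :: l} :=
      Set.image_mono fun y hy => List.mem_cons_of_mem _ hy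
    rw [bitSpan, List.mem_append, List.mem_map] at h
    rcases h with h | ⟨m, h, rfl⟩
    · exact Submodule.span_mono hs (ih h)
    · rw [← bitWord_add]
      exact add_mem (Submodule.subset_span ⟨x, by simp, rfl⟩) (Submodule.span_mono hs (ih h))

/-- Whether a test holds for all codes of words of length `n`. -/
def allBits : ℕ → (ℕ → Bool) → Bool
  | 0, f => f 0
  | n + 1, f => allBits n (fun k => f (2 * k)) && allBits n (fun k => f (2 * k + 1))

lemma allBits_spec {n : ℕ} {f : ℕ → Bool} (h : allBits n f = true) {k : ℕ} (hk : k < 2 ^ n) :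
    f k = true := by
  induction n generalizing f k with
  | zero =>
    obtain rfl : k = 0 := by simpa using hk
    exact h
  | succ n ih =>
    rw [allBits, Bool.and_eq_true] at h
    have h2 : k / 2 < 2 ^ n := by omega
    rcases Nat.mod_two_eq_zero_or_one k with hm | hm
    · have := ih h.1 h2
      rwa [show 2 * (k / 2) = k by omega] at this
    · have := ih h.2 h2
      rwa [show 2 * (k / 2) + 1 = k by omega] at this

/-- Whether all words that pass the test `f` and commute with the words in `X` are sums of
words in `X`. -/
def bitMaximal (n : ℕ) (X : List ℕ) (f : ℕ → Bool) : Bool :=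
  allBits n fun k => !(f k && X.all fun x => bitCommute n x k) || (bitSpan X).contains k

lemma bitMaximal_spec {n : ℕ} {X : List ℕ} {f : ℕ → Bool} (h : bitMaximal n X f = true)
    {k : ℕ} (hk : k < 2 ^ n) (hf : f k = true)
    (hX : ∀ x ∈ bitWord n '' {x | x ∈ X}, commForm x (bitWord n k) = 0) :
    bitWord n k ∈ Submodule.span (ZMod 2) (bitWord n '' {x | x ∈ X}) := by
  have h1 := allBits_spec h hk
  have h2 : (X.all fun x => bitCommute n x k) = true := by
    rw [List.all_eq_true]
    exact fun x hx => (bitCommute_iff n x k).2 (hX _ ⟨x, hx, rfl⟩)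
  rw [hf, h2] at h1
  exact bitWord_mem_span (by simpa using h1)

/-- A test for `HasShortMaximal`. -/
def bitShortMaximal (n m : ℕ) (X : List ℕ) : Bool :=
  (X.all fun x => (bitCount n x == 3 || bitCount n x == 4) && bitParity n m x) &&
    (X.all fun x => X.all fun y => bitCommute n x y) &&
    bitMaximal n X fun k =>
      bitParity n m k && (bitCount n k % 4 == 0 || bitCount n k % 4 == 3)

lemma hasShortMaximal_of_bits {n m : ℕ} {X : List ℕ} (h : bitShortMaximal n m X = true) :
    HasShortMaximal (bitWord n m) := by
  rw [bitShortMaximal, Bool.and_eq_true, Bool.and_eq_true, List.all_eq_true,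
    List.all_eq_true] at h
  obtain ⟨⟨h1, h2⟩, h3⟩ := h
  refine ⟨bitWord n '' {x | x ∈ X}, ?_, ?_, ?_⟩
  · rintro _ ⟨x, hx, rfl⟩
    have := h1 x hx
    rw [Bool.and_eq_true, bitParity_iff] at this
    rw [weight_bitWord]
    exact ⟨by simpa using this.1, this.2⟩
  · rintro _ ⟨x, hx, rfl⟩ _ ⟨y, hy, rfl⟩
    exact (bitCommute_iff n x y).1 (List.all_eq_true.1 (h2 x hx) y hy)
  · intro y hy hX
    obtain ⟨k, hk, rfl⟩ := exists_bitWord y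
    refine bitMaximal_spec h3 hk ?_ hX
    rw [Bool.and_eq_true, bitParity_iff]
    refine ⟨hy.2, ?_⟩
    have := hy.1
    rw [weight_bitWord] at this
    simpa using this

/-- Codes of words of weight three and four that span maximal totally singular spaces, for small
numbers of positive and negative letters. -/
def shortWords (r s : ℕ) : List ℕ :=
  match r with
  | 0 => [[], [], [], [], [15], [15], [15, 51], [15, 51, 85]].getD s []
  | 1 => [[], [], [7], [7], [7, 25], [7, 25], [7, 25, 97], [7, 25, 97]].getD s []
  -- In the rows for 2 and 3 the default serves every `s ≥ 4`; the defaults of the other rows are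
  -- never reached in the tested range.
  | 2 => [[], [], [13], [13, 22]].getD s [13, 22, 39]
  | 3 => [[7], [7], [7, 25], [7, 25, 42]].getD s [7, 25, 42, 75]
  | 4 => [[7], [7], [7, 49], [7, 49, 82]].getD s []
  | 5 => [[7, 25], [7, 25], [7, 25, 97], [7, 25, 97]].getD s []
  | 6 => [7, 25, 42]
  | _ => [7, 25, 42, 75]

/-- These are the cases left after removing blocks of eight positive, eight negative, or four
positive and four negative letters. The mask has its ones at the places from `r` to `r + s - 1`, the
negative letters. -/
lemma shortWords_maximal : ∀ r < 8, ∀ s < 8, r < 4 ∨ s < 4 →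
    bitShortMaximal (r + s) (2 ^ r * (2 ^ s - 1)) (shortWords r s) = true := by
  decide +kernel

lemma bitWord_mask (r s : ℕ) :
    bitWord (r + s) (2 ^ r * (2 ^ s - 1)) ∘ finSumFinEquiv =
      Sum.elim (fun _ => (0 : ZMod 2)) (fun _ => 1) := by
  ext (i | i)
  · simp [bitWord, Nat.testBit_two_pow_mul]
  · simp [bitWord, Nat.testBit_two_pow_mul]

/-- The indicator of the negative letters. -/
def negMark (r s : ℕ) : Fin r ⊕ Fin s → ZMod 2 := Sum.elim (fun _ => 0) (fun _ => 1)

/-- The codes 15, 51, 85, 240 generate the extended Hamming code of length eight, which is self-dual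
and generated by words of weight four. On even words `commForm` is the dot product, so this is the
self-dual block required by `HasShortMaximal.sumElim`. -/
lemma HasShortMaximal.sumElim_eight {ι : Type} [Fintype ι] {ν : ι → ZMod 2}
    (h : HasShortMaximal ν) {m : ℕ}
    (hm : ∀ x ∈ [15, 51, 85, 240], bitParity 8 m x = true) :
    HasShortMaximal (Sum.elim ν (bitWord 8 m)) := by
  refine h.sumElim (Y := bitWord 8 '' {x | x ∈ [15, 51, 85, 240]}) ?_ ?_ ?_
  · rintro _ ⟨x, hx, rfl⟩
    refine ⟨?_, (bitParity_iff 8 m x).1 (hm x hx)⟩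
    rw [weight_bitWord]
    have : ∀ x ∈ [15, 51, 85, 240], bitCount 8 x = 4 := by decide
    exact this x hx
  · rintro _ ⟨x, hx, rfl⟩ _ ⟨y, hy, rfl⟩
    rw [← bitCommute_iff]
    have : ∀ x ∈ [15, 51, 85, 240], ∀ y ∈ [15, 51, 85, 240], bitCommute 8 x y = true := by
      decide
    exact this x hx y hy
  · intro y hy
    obtain ⟨k, hk, rfl⟩ := exists_bitWord y
    have : bitMaximal 8 [15, 51, 85, 240] (fun _ => true) = true := by decide +kernel
    exact bitMaximal_spec this hk rfl hy

/-- Periodicity in (8,0), (0,8) and (4,4): each step splits off one Hamming block, marked by 0, 255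
or 240. These marks are themselves codewords, so they meet every generator evenly. -/
theorem hasShortMaximal_negMark (r s : ℕ) : HasShortMaximal (negMark r s) := by
  by_cases hr : 8 ≤ r
  · obtain ⟨r, rfl⟩ := Nat.exists_eq_add_of_le' hr
    have := (hasShortMaximal_negMark r s).sumElim_eight (m := 0) (by decide)
    have := this.comp_equiv ((Equiv.sumCongr finSumFinEquiv.symm (Equiv.refl (Fin s))).trans
      ((Equiv.sumAssoc _ _ _).trans ((Equiv.sumCongr (Equiv.refl _) (Equiv.sumComm _ _)).trans
        (Equiv.sumAssoc _ _ _).symm)))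
    convert this using 1
    ext (i | i)
    · refine Fin.addCases (fun i => ?_) (fun i => ?_) i <;> simp [negMark, bitWord]
    · simp [negMark]
  by_cases hs : 8 ≤ s
  · obtain ⟨s, rfl⟩ := Nat.exists_eq_add_of_le' hs
    have := (hasShortMaximal_negMark r s).sumElim_eight (m := 255) (by decide)
    have := this.comp_equiv ((Equiv.sumCongr (Equiv.refl (Fin r)) finSumFinEquiv.symm).trans
      (Equiv.sumAssoc _ _ _).symm)
    convert this using 1
    have h255 : ∀ i : Fin 8, bitWord 8 255 i = 1 := by decide
    ext (i | i)
    · simp [negMark]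
    · refine Fin.addCases (fun i => ?_) (fun i => ?_) i <;> simp [negMark, h255]
  by_cases hrs : 4 ≤ r ∧ 4 ≤ s
  · obtain ⟨r, rfl⟩ := Nat.exists_eq_add_of_le' hrs.1
    obtain ⟨s, rfl⟩ := Nat.exists_eq_add_of_le' hrs.2
    have := (hasShortMaximal_negMark r s).sumElim_eight (m := 240) (by decide)
    have := this.comp_equiv ((Equiv.sumCongr finSumFinEquiv.symm finSumFinEquiv.symm).trans
      ((Equiv.sumSumSumComm (Fin r) (Fin 4) (Fin s) (Fin 4)).trans
        (Equiv.sumCongr (Equiv.refl _) (finSumFinEquiv (m := 4) (n := 4)))))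
    convert this using 1
    have h0 : ∀ i : Fin 4, bitWord 8 240 (finSumFinEquiv (m := 4) (n := 4) (Sum.inl i)) = 0 := by decide
    have h1 : ∀ i : Fin 4, bitWord 8 240 (finSumFinEquiv (m := 4) (n := 4) (Sum.inr i)) = 1 := by decide
    ext (i | i)
    · refine Fin.addCases (fun i => ?_) (fun i => ?_) i <;> simp [negMark, -finSumFinEquiv_apply_left, h0]
    · refine Fin.addCases (fun i => ?_) (fun i => ?_) i <;> simp [negMark, -finSumFinEquiv_apply_right, h1]
  · have := (hasShortMaximal_of_bits
      (shortWords_maximal r (by omega) s (by omega) (by omega))).comp_equiv finSumFinEquiv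
    rwa [bitWord_mask] at this
termination_by r + s

end Bits

/-! ### Signs and words of monomials -/

/-- The sign `(-1)^a`. -/
def sgn (a : ZMod 2) : ℝ := if a = 0 then 1 else -1

@[simp] lemma sgn_zero : sgn 0 = 1 := if_pos rfl

@[simp] lemma sgn_one : sgn 1 = -1 := if_neg one_ne_zero

lemma sgn_add (a b : ZMod 2) : sgn (a + b) = sgn a * sgn b := by
  rcases zmod_two_cases a with rfl | rfl <;> rcases zmod_two_cases b with rfl | rfl
  · simp
  · simp
  · simp
  · rw [show (1 : ZMod 2) + 1 = 0 from rfl]; simp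

lemma sgn_cases (a : ZMod 2) : sgn a = 1 ∨ sgn a = -1 := by
  rcases zmod_two_cases a with rfl | rfl <;> simp

lemma sgn_mul_self (a : ZMod 2) : sgn a * sgn a = 1 := by
  rcases sgn_cases a with h | h <;> simp [h]

lemma word_add_self {ι : Type} (x : ι → ZMod 2) : x + x = 0 := by
  ext i; exact CharTwo.add_self_eq_zero _

lemma word_eq_of_add_eq_zero {ι : Type} {x y : ι → ZMod 2} (h : x + y = 0) : x = y := by
  rw [← add_zero x, ← word_add_self y, ← add_assoc, h, zero_add]

/-- The letters of a word. -/
def letters {ι : Type} [Fintype ι] (x : ι → ZMod 2) : List ι :=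
  (Finset.univ.filter fun i => x i ≠ 0).toList

lemma nodup_letters {ι : Type} [Fintype ι] (x : ι → ZMod 2) : (letters x).Nodup :=
  Finset.nodup_toList _

section ListWord

variable {ι : Type} [DecidableEq ι]

/-- The word of a monomial: the letters that occur an odd number of times. -/
def wordOf (l : List ι) : ι → ZMod 2 := (l.map fun i => Pi.single i 1).sum

@[simp] lemma wordOf_nil : wordOf ([] : List ι) = 0 := rfl

@[simp] lemma wordOf_cons (i : ι) (l : List ι) :
    wordOf (i :: l) = Pi.single i 1 + wordOf l := by simp [wordOf]

@[simp] lemma wordOf_append (l l' : List ι) : wordOf (l ++ l') = wordOf l + wordOf l' := by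
  simp [wordOf]

@[simp] lemma wordOf_reverse (l : List ι) : wordOf l.reverse = wordOf l := by
  simp [wordOf, List.sum_reverse]

lemma wordOf_apply {l : List ι} (hl : l.Nodup) (i : ι) :
    wordOf l i = if i ∈ l then 1 else 0 := by
  induction l with
  | nil => simp
  | cons j t ih =>
    rw [List.nodup_cons] at hl
    rw [wordOf_cons, Pi.add_apply, ih hl.2, Pi.single_apply]
    by_cases h : i = j
    · subst h; simp [hl.1]
    · simp [h]

lemma wordOf_apply_of_notMem {l : List ι} {i : ι} (h : i ∉ l) : wordOf l i = 0 := by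
  induction l with
  | nil => simp
  | cons j t ih =>
    rw [List.mem_cons, not_or] at h
    simp [ih h.2, h.1]

variable [Fintype ι]

lemma weight_wordOf {l : List ι} (hl : l.Nodup) : weight (wordOf l) = l.length := by
  have h : ∀ i, (wordOf l i).val = if i ∈ l.toFinset then 1 else 0 := by
    intro i
    rw [wordOf_apply hl]
    by_cases h : i ∈ l <;> simp [h]
    rfl
  simp only [weight, h]
  rw [Finset.sum_boole, Finset.filter_mem_eq_inter, Finset.univ_inter,
    List.toFinset_card_of_nodup hl, Nat.cast_id]

@[simp] lemma wordOf_letters (x : ι → ZMod 2) : wordOf (letters x) = x := by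
  ext i
  rw [wordOf_apply (nodup_letters x)]
  rcases zmod_two_cases (x i) with h | h <;> simp [letters, h]

lemma length_letters (x : ι → ZMod 2) : (letters x).length = weight x := by
  rw [← weight_wordOf (nodup_letters x), wordOf_letters]

lemma commForm_single (i : ι) (x : ι → ZMod 2) :
    commForm (Pi.single i 1) x = ∑ j, x j + x i := by
  simp [commForm_apply, Pi.single_apply]

end ListWord

section Parity

variable {r s : ℕ}

lemma parity_wordOf (l : List (Fin r ⊕ Fin s)) :
    parity (negMark r s) (wordOf l) = (negCount l : ZMod 2) := by
  induction l with
  | nil => simp [negCount]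
  | cons i t ih =>
    have h : parity (negMark r s) (Pi.single i 1) = negMark r s i := by
      simp [parity_apply, Pi.single_apply]
    rw [wordOf_cons, map_add, ih, h, negCount, negCount, List.countP_cons]
    rcases i with i | i <;> simp [negMark, add_comm]

lemma parity_wordOf_eq_zero_iff (l : List (Fin r ⊕ Fin s)) :
    parity (negMark r s) (wordOf l) = 0 ↔ negCount l % 2 = 0 := by
  rw [parity_wordOf, ZMod.natCast_eq_zero_iff_even, Nat.even_iff]

end Parity

/-! ### Clifford monomials -/

section Monomials

variable {r s : ℕ} {z : Module.Basis (Fin r ⊕ Fin s) ℝ (RS r s)}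

@[simp] lemma monomial_nil : monomial z [] = 1 := rfl

@[simp] lemma monomial_cons (i : Fin r ⊕ Fin s) (l : List (Fin r ⊕ Fin s)) :
    monomial z (i :: l) = gen (z i) * monomial z l := by simp [monomial]

@[simp] lemma monomial_append (l l' : List (Fin r ⊕ Fin s)) :
    monomial z (l ++ l') = monomial z l * monomial z l' := by simp [monomial]

/-- The square of a basis vector. -/
def basisSign (r s : ℕ) : Fin r ⊕ Fin s → ℝ := Sum.elim (fun _ => 1) (fun _ => -1)

lemma basisSign_eq (i : Fin r ⊕ Fin s) : basisSign r s i = sgn (negMark r s i) := by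
  rcases i with i | i <;> simp [basisSign, negMark]

lemma gen_mul_self (hz : IsOrthonormalBasis z) (i : Fin r ⊕ Fin s) :
    gen (z i) * gen (z i) = -(basisSign r s i) • (1 : Cl r s) := by
  have h : Qrs r s (z i) = basisSign r s i := by
    have : innerRS (z i) (z i) = Qrs r s (z i) := QuadraticMap.associated_eq_self_apply ℝ _ _
    rw [← this]
    rcases i with i | i
    · exact hz.2.1 i
    · exact hz.2.2 i
  rw [gen, CliffordAlgebra.ι_sq_scalar, Algebra.algebraMap_eq_smul_one,
    neg_apply, h]

lemma gen_mul_gen (hz : IsOrthonormalBasis z) {i j : Fin r ⊕ Fin s} (hij : i ≠ j) :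
    gen (z i) * gen (z j) = -(gen (z j) * gen (z i)) := by
  have h : QuadraticMap.polar (-Qrs r s) (z i) (z j) = 0 := by
    have := hz.1 i j hij
    rw [innerRS, QuadraticMap.associated_apply] at this
    simp only [QuadraticMap.polar, neg_apply]
    simp at this
    linarith
  rw [eq_neg_iff_add_eq_zero, gen, gen, CliffordAlgebra.ι_mul_ι_add_swap, h, map_zero]

lemma gen_mul_monomial (hz : IsOrthonormalBasis z) (i : Fin r ⊕ Fin s)
    (l : List (Fin r ⊕ Fin s)) :
    gen (z i) * monomial z l =
      sgn (commForm (Pi.single i 1) (wordOf l)) • (monomial z l * gen (z i)) := by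
  induction l with
  | nil => simp
  | cons j t ih =>
    have h : gen (z i) * gen (z j) =
        sgn (commForm (Pi.single i 1) (Pi.single j 1)) • (gen (z j) * gen (z i)) := by
      rw [commForm_single]
      by_cases hij : i = j
      · subst hij
        simp [CharTwo.add_self_eq_zero]
      · rw [gen_mul_gen hz hij]
        simp [Pi.single_apply, hij]
    rw [monomial_cons, ← mul_assoc, h, wordOf_cons, map_add, sgn_add, smul_mul_assoc, mul_assoc,
      ih, mul_smul_comm, smul_smul, mul_assoc]

lemma monomial_mul_monomial (hz : IsOrthonormalBasis z) (l l' : List (Fin r ⊕ Fin s)) :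
    monomial z l * monomial z l' =
      sgn (commForm (wordOf l) (wordOf l')) • (monomial z l' * monomial z l) := by
  induction l with
  | nil => simp
  | cons i t ih =>
    rw [monomial_cons, mul_assoc, ih, mul_smul_comm, ← mul_assoc, gen_mul_monomial hz,
      smul_mul_assoc, smul_smul, wordOf_cons, map_add, LinearMap.add_apply, sgn_add, mul_comm,
      mul_assoc]

lemma eq_zero_of_eq_neg {M : Type*} [AddCommGroup M] [Module ℝ M] {x : M} (h : x = -x) :
    x = 0 := by
  have h2 : (2 : ℝ) • x = 0 := by
    rw [two_smul]; nth_rewrite 2 [h]; exact add_neg_cancel x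
  exact (smul_eq_zero.1 h2).resolve_left two_ne_zero

lemma smul_eq_or_eq_neg {M : Type*} [AddCommGroup M] [Module ℝ M] {c : ℝ} (hc : c = 1 ∨ c = -1)
    {x y : M} (h : x = y ∨ x = -y) : c • x = y ∨ c • x = -y := by
  rcases hc with rfl | rfl <;> rcases h with rfl | rfl <;> simp

/-- The first letter must occur again. Moving it next to its second occurrence costs a sign, its
square is a sign, and a shorter monomial with the same word remains. -/
lemma monomial_eq_one_or (hz : IsOrthonormalBasis z) (l : List (Fin r ⊕ Fin s))
    (h : wordOf l = 0) : monomial z l = 1 ∨ monomial z l = -1 := by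
  induction hn : l.length using Nat.strong_induction_on generalizing l with
  | _ n ih =>
    cases l with
    | nil => simp
    | cons i t =>
      have hi : i ∈ t := by
        by_contra hi
        have := congrFun h i
        simp [wordOf_apply_of_notMem hi] at this
      obtain ⟨a, b, rfl⟩ := List.append_of_mem hi
      have hab : wordOf (a ++ b) = 0 := by
        rw [← h]
        simp only [wordOf_cons, wordOf_append]
        rw [add_left_comm (wordOf a), ← add_assoc (Pi.single i 1), word_add_self, zero_add]
      have hlen : (a ++ b).length < n := by
        rw [← hn]; simp
      have e : monomial z (i :: (a ++ i :: b)) =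
          (sgn (commForm (Pi.single i 1) (wordOf a)) * -(basisSign r s i)) •
            monomial z (a ++ b) := by
        rw [monomial_cons, monomial_append, ← mul_assoc, gen_mul_monomial hz, monomial_cons,
          smul_mul_assoc, mul_assoc, ← mul_assoc (gen (z i)), gen_mul_self hz, smul_mul_assoc,
          one_mul, mul_smul_comm, smul_smul, monomial_append]
      rw [e]
      refine smul_eq_or_eq_neg ?_ (ih _ hlen _ hab rfl)
      rw [basisSign_eq]
      rcases sgn_cases (commForm (Pi.single i 1) (wordOf a)) with h1 | h1 <;>
        rcases sgn_cases (negMark r s i) with h2 | h2 <;> simp [h1, h2]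

lemma monomial_eq_or_eq_neg (hz : IsOrthonormalBasis z) {l l' : List (Fin r ⊕ Fin s)}
    (h : wordOf l = wordOf l') : monomial z l = monomial z l' ∨ monomial z l = -monomial z l' := by
  have h1 := monomial_eq_one_or hz (l ++ l'.reverse) (by simp [h, word_add_self])
  have h2 := monomial_eq_one_or hz (l'.reverse ++ l') (by simp [word_add_self])
  rw [monomial_append] at h1 h2
  have h3 : monomial z l * (monomial z l'.reverse * monomial z l') =
      (monomial z l * monomial z l'.reverse) * monomial z l' := (mul_assoc _ _ _).symm
  rcases h1 with h1 | h1 <;> rcases h2 with h2 | h2 <;> rw [h1, h2] at h3 <;> simp at h3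
  · exact Or.inl h3
  · exact Or.inr (neg_eq_iff_eq_neg.1 h3)
  · exact Or.inr h3
  · exact Or.inl h3

lemma involute_monomial (l : List (Fin r ⊕ Fin s)) :
    CliffordAlgebra.involute (monomial z l) = sgn (∑ i, wordOf l i) • monomial z l := by
  induction l with
  | nil => simp
  | cons i t ih =>
    have h : ∑ j, (Pi.single i 1 : Fin r ⊕ Fin s → ZMod 2) j = 1 := by simp
    rw [monomial_cons, map_mul, ih, gen, CliffordAlgebra.involute_ι, wordOf_cons]
    simp only [Pi.add_apply, Finset.sum_add_distrib]
    rw [h, sgn_add, sgn_one, mul_smul_comm, neg_mul, smul_neg, neg_mul, neg_smul, one_mul]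

/-- Monomials with different words are independent. -/
lemma wordOf_eq_of_monomial [Nontrivial (Cl r s)] (hz : IsOrthonormalBasis z)
    {l l' : List (Fin r ⊕ Fin s)}
    (h : monomial z l = monomial z l' ∨ monomial z l = -monomial z l') :
    wordOf l = wordOf l' := by
  have h2 := monomial_eq_one_or hz (l' ++ l'.reverse) (by simp [word_add_self])
  have h1 : monomial z (l ++ l'.reverse) = 1 ∨ monomial z (l ++ l'.reverse) = -1 := by
    rw [monomial_append] at h2 ⊢
    rcases h with h | h <;> rcases h2 with h2 | h2 <;> simp [h, h2]
  have h0 : wordOf (l ++ l'.reverse) = wordOf l + wordOf l' := by simp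
  refine word_eq_of_add_eq_zero (h0 ▸ ?_)
  generalize l ++ l'.reverse = m at h1
  -- A monomial equal to `±1` commutes with all generators, which forces all letters of its word to
  -- be equal.
  have hcomm : ∀ i, ∑ j, wordOf m j + wordOf m i = 0 := by
    intro i
    have h3 := gen_mul_monomial hz i m
    rw [← commForm_single]
    rcases zmod_two_cases (commForm (Pi.single i 1) (wordOf m)) with h4 | h4
    · exact h4
    · exfalso
      have h5 : gen (z i) = 0 := by
        rw [h4, sgn_one] at h3
        rcases h1 with h1 | h1 <;> rw [h1] at h3
        · exact eq_zero_of_eq_neg (by simpa using h3)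
        · exact eq_zero_of_eq_neg (by simpa using h3.symm)
      have h6 := gen_mul_self hz i
      rw [h5, mul_zero, eq_comm, smul_eq_zero] at h6
      rcases h6 with h6 | h6
      · rw [basisSign_eq] at h6
        rcases sgn_cases (negMark r s i) with h7 | h7 <;> simp [h7] at h6
      · exact one_ne_zero h6
  -- The remaining danger is the full word of odd length, which is central. The grade involution
  -- negates it but fixes `±1`.
  have hs : ∑ j, wordOf m j = 0 := by
    rcases zmod_two_cases (∑ j, wordOf m j) with h3 | h3
    · exact h3
    · exfalso
      have h4 := involute_monomial (z := z) m
      rw [h3, sgn_one] at h4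
      have h5 : (1 : Cl r s) = -1 := by
        rcases h1 with h1 | h1 <;> rw [h1] at h4 <;> simpa [eq_comm] using h4
      exact one_ne_zero (eq_zero_of_eq_neg h5)
  ext i
  simpa [hs] using hcomm i

end Monomials

/-! ### The words of a system of involutions -/

section Families

variable {r s : ℕ} {z : Module.Basis (Fin r ⊕ Fin s) ℝ (RS r s)} {p : ℕ}

lemma monomial_ne_zero [Nontrivial (Cl r s)] (hz : IsOrthonormalBasis z)
    (l : List (Fin r ⊕ Fin s)) : monomial z l ≠ 0 := by
  intro h
  have := monomial_eq_one_or hz (l ++ l.reverse) (by simp [word_add_self])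
  rw [monomial_append, h, zero_mul] at this
  rcases this with h | h
  · exact zero_ne_one h
  · exact one_ne_zero (neg_eq_zero.1 h.symm)

lemma exists_short_monomial {x : Cl r s} (hx : IsQuadruple z x ∨ IsTriple z x) :
    ∃ l : List (Fin r ⊕ Fin s), x = monomial z l ∧
      (weight (wordOf l) = 4 ∨ weight (wordOf l) = 3 ∧ IsTriple z x) ∧
      parity (negMark r s) (wordOf l) = 0 := by
  rcases hx with ⟨l, h1, h2, h3, h4⟩ | h
  · refine ⟨l, h4, Or.inl (by rw [weight_wordOf h1, h2]), ?_⟩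
    rw [parity_wordOf_eq_zero_iff]; omega
  · obtain ⟨l, h1, h2, h3, h4⟩ := id h
    refine ⟨l, h4, Or.inr ⟨by rw [weight_wordOf h1, h2], h⟩, ?_⟩
    rw [parity_wordOf_eq_zero_iff]; omega

lemma isQuadruple_or_isTriple_of_word {x : Fin r ⊕ Fin s → ZMod 2}
    (hx : weight x = 3 ∨ weight x = 4) (hν : parity (negMark r s) x = 0) :
    IsQuadruple z (monomial z (letters x)) ∨ IsTriple z (monomial z (letters x)) := by
  have h1 : negCount (letters x) ≤ (letters x).length := List.countP_le_length
  have h2 : negCount (letters x) % 2 = 0 := by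
    rwa [← parity_wordOf_eq_zero_iff, wordOf_letters]
  rw [length_letters] at h1
  rcases hx with h | h
  · exact Or.inr ⟨letters x, nodup_letters x, by rw [length_letters, h], by omega, rfl⟩
  · exact Or.inl ⟨letters x, nodup_letters x, by rw [length_letters, h], by omega, rfl⟩

lemma commForm_self {ι : Type} [Fintype ι] (y : ι → ZMod 2) : commForm y y = 0 := by
  have h : ∀ a : ZMod 2, a * a = a := by decide
  simp only [commForm_apply, h, CharTwo.add_self_eq_zero]

lemma commForm_eq_zero_of_commute [Nontrivial (Cl r s)] (hz : IsOrthonormalBasis z)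
    {l l' : List (Fin r ⊕ Fin s)}
    (h : monomial z l * monomial z l' = monomial z l' * monomial z l) :
    commForm (wordOf l) (wordOf l') = 0 := by
  rcases zmod_two_cases (commForm (wordOf l) (wordOf l')) with h1 | h1
  · exact h1
  · exfalso
    have h2 := monomial_mul_monomial hz l l'
    rw [h1, sgn_one, neg_one_smul, ← h] at h2
    rw [← monomial_append] at h2
    exact monomial_ne_zero hz _ (eq_zero_of_eq_neg h2)

lemma exists_monomial_of_mem_span {P : Fin p → Cl r s} {l : Fin p → List (Fin r ⊕ Fin s)}
    (hl : ∀ k, P k = monomial z (l k)) {S : Set (Fin p)} {y : Fin r ⊕ Fin s → ZMod 2}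
    (hy : y ∈ Submodule.span (ZMod 2) ((fun k => wordOf (l k)) '' S)) :
    ∃ m, wordOf m = y ∧ monomial z m ∈ Submonoid.closure (P '' S) := by
  induction hy using Submodule.span_induction with
  | mem _ hx =>
    obtain ⟨k, hk, rfl⟩ := hx
    exact ⟨l k, rfl, Submonoid.subset_closure ⟨k, hk, hl k⟩⟩
  | zero => exact ⟨[], rfl, one_mem _⟩
  | add a b _ _ ha hb =>
    obtain ⟨m, rfl, hm⟩ := ha
    obtain ⟨m', rfl, hm'⟩ := hb
    exact ⟨m ++ m', by simp, by rw [monomial_append]; exact mul_mem hm hm'⟩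
  | smul c a _ ha =>
    rcases zmod_two_cases c with rfl | rfl
    · exact ⟨[], by simp, one_mem _⟩
    · rwa [one_smul]

lemma exists_word_of_mem_closure {P : Fin p → Cl r s} {l : Fin p → List (Fin r ⊕ Fin s)}
    (hl : ∀ k, P k = monomial z (l k)) {S : Set (Fin p)} {y : Cl r s}
    (hy : y ∈ Submonoid.closure (insert (-1) (P '' S))) :
    ∃ m, (y = monomial z m ∨ y = -monomial z m) ∧
      wordOf m ∈ Submodule.span (ZMod 2) ((fun k => wordOf (l k)) '' S) := by
  induction hy using Submonoid.closure_induction with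
  | mem _ hx =>
    rcases hx with rfl | ⟨k, hk, rfl⟩
    · exact ⟨[], Or.inr rfl, zero_mem _⟩
    · exact ⟨l k, Or.inl (hl k), Submodule.subset_span ⟨k, hk, rfl⟩⟩
  | one => exact ⟨[], Or.inl rfl, zero_mem _⟩
  | mul a b _ _ ha hb =>
    obtain ⟨m, hm, hm2⟩ := ha
    obtain ⟨m', hm', hm2'⟩ := hb
    refine ⟨m ++ m', ?_, by rw [wordOf_append]; exact add_mem hm2 hm2'⟩
    rw [monomial_append]
    rcases hm with rfl | rfl <;> rcases hm' with rfl | rfl <;> simp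

/-- A linear relation among words lifts to a relation among monomials up to sign; this is why `-1`
is among the generators in the independence condition. -/
lemma IsInvolutionFamily.linearIndependent (hz : IsOrthonormalBasis z) {P : Fin p → Cl r s}
    (hP : IsInvolutionFamily z P) {l : Fin p → List (Fin r ⊕ Fin s)}
    (hl : ∀ k, P k = monomial z (l k)) : LinearIndependent (ZMod 2) fun k => wordOf (l k) := by
  rw [linearIndependent_iff_notMem_span]
  intro k hk
  obtain ⟨m, hm, hm'⟩ := exists_monomial_of_mem_span hl hk
  have hS : Submonoid.closure (P '' (Set.univ \ {k})) ≤
      Submonoid.closure (insert (-1) (P '' {j | j ≠ k})) := by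
    refine Submonoid.closure_mono ((Set.image_mono ?_).trans (Set.subset_insert _ _))
    intro j hj; simpa using hj
  refine hP.indep k ?_
  rw [hl k]
  rcases monomial_eq_or_eq_neg hz hm.symm with h | h
  · rw [h]; exact hS hm'
  · rw [h, ← neg_one_mul (monomial z m)]
    exact mul_mem (Submonoid.subset_closure (Set.mem_insert _ _)) (hS hm')

lemma isInvolutionFamily_of_words [Nontrivial (Cl r s)] (hz : IsOrthonormalBasis z)
    {x : Fin p → Fin r ⊕ Fin s → ZMod 2}
    (hx : ∀ k, (weight (x k) = 3 ∨ weight (x k) = 4) ∧ parity (negMark r s) (x k) = 0)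
    (hc : ∀ j k, commForm (x j) (x k) = 0) (hi : LinearIndependent (ZMod 2) x) :
    IsInvolutionFamily z fun k => monomial z (letters (x k)) where
  type k := isQuadruple_or_isTriple_of_word (hx k).1 (hx k).2
  comm i j := by
    rw [monomial_mul_monomial hz, wordOf_letters, wordOf_letters, hc, sgn_zero, one_smul]
  indep k hk := by
    obtain ⟨m, hm, hm'⟩ := exists_word_of_mem_closure (fun _ => rfl) hk
    have := wordOf_eq_of_monomial hz hm
    simp only [wordOf_letters] at this hm'
    rw [linearIndependent_iff_notMem_span] at hi
    refine hi k ?_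
    rw [this]
    have hS : (Set.univ \ {k} : Set (Fin p)) = {j | j ≠ k} := by ext j; simp
    rw [hS]
    exact hm'

/-- The words of a maximal system of involutions. -/
structure IsWordSystem (z : Module.Basis (Fin r ⊕ Fin s) ℝ (RS r s)) (P : Fin p → Cl r s)
    (l : Fin p → List (Fin r ⊕ Fin s)) : Prop where
  eq_monomial : ∀ k, P k = monomial z (l k)
  weight_eq : ∀ k, weight (wordOf (l k)) = 4 ∨ weight (wordOf (l k)) = 3 ∧ IsTriple z (P k)
  linearIndependent : LinearIndependent (ZMod 2) fun k => wordOf (l k)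
  maximal : MaximalSingular (negMark r s)
    (Submodule.span (ZMod 2) (Set.range fun k => wordOf (l k)))

/-- A basis of the short maximal space, chosen among its words of weight three and four, is itself
an involution family, so `p` is at least the dimension of that space. If a singular word commuting
with the system lay outside its span, adjoining it would give a totally singular space of larger
dimension, against `MaximalSingular.finrank_le`. -/
theorem IsPI.exists_isWordSystem [Nontrivial (Cl r s)] (hz : IsOrthonormalBasis z)
    {P : Fin p → Cl r s} (hP : IsPI z P) : ∃ l, IsWordSystem z P l := by
  choose l hl hw hν using fun k => exists_short_monomial (hP.family.type k)
  have hi := hP.family.linearIndependent hz hl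
  have hc : ∀ j k, commForm (wordOf (l j)) (wordOf (l k)) = 0 := by
    intro j k
    refine commForm_eq_zero_of_commute hz ?_
    rw [← hl, ← hl, hP.family.comm]
  have hsing : ∀ k, IsSingular (negMark r s) (wordOf (l k)) := by
    intro k
    refine ⟨?_, hν k⟩
    have := hw k
    omega
  have hG : TotallySingular (negMark r s)
      (Submodule.span (ZMod 2) (Set.range fun k => wordOf (l k))) := by
    refine totallySingular_span ?_ ?_
    · rintro _ ⟨k, rfl⟩; exact hsing k
    · rintro _ ⟨j, rfl⟩ _ ⟨k, rfl⟩; exact hc j k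
  refine ⟨l, hl, hw, hi, hG, fun y hy hyG => ?_⟩
  obtain ⟨X, hX1, hX2, hX3⟩ := hasShortMaximal_negMark r s
  have hX : MaximalSingular (negMark r s) (Submodule.span (ZMod 2) X) := by
    refine ⟨totallySingular_span (fun x hx => ⟨?_, (hX1 x hx).2⟩) hX2, fun y hy h => ?_⟩
    · have := (hX1 x hx).1
      omega
    · exact hX3 y hy fun x hx => h x (Submodule.subset_span hx)
  obtain ⟨b, hbX, hb, hbi⟩ := exists_linearIndependent (ZMod 2) X
  have : Fintype b := Fintype.ofFinite b
  have hq : Fintype.card b ≤ p := by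
    let e := Fintype.equivFin b
    refine hP.maximal _ _ (isInvolutionFamily_of_words hz (x := fun k => (e.symm k : b).1)
      (fun k => hX1 _ (hbX (e.symm k).2)) (fun j k => hX2 _ (hbX (e.symm j).2) _
      (hbX (e.symm k).2)) ?_)
    exact hbi.comp _ e.symm.injective
  have hfr : Module.finrank (ZMod 2) (Submodule.span (ZMod 2) X) = Fintype.card b := by
    have := finrank_span_eq_card hbi
    rwa [Subtype.range_coe, hb] at this
  have hfp := finrank_span_eq_card hi
  rw [Fintype.card_fin] at hfp
  have hG' : TotallySingular (negMark r s)
      (Submodule.span (ZMod 2) (insert y (Set.range fun k => wordOf (l k)))) := by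
    have h1 : ∀ k, commForm (wordOf (l k)) y = 0 := fun k =>
      hyG _ (Submodule.subset_span ⟨k, rfl⟩)
    refine totallySingular_span ?_ ?_
    · rintro _ (rfl | ⟨k, rfl⟩)
      · exact hy
      · exact hsing k
    · rintro _ (rfl | ⟨j, rfl⟩) _ (rfl | ⟨k, rfl⟩)
      · exact commForm_self _
      · rw [commForm_comm]; exact h1 k
      · exact h1 j
      · exact hc j k
  have hle := hX.finrank_le hG'
  have heq := Submodule.eq_of_le_of_finrank_le (K := ZMod 2)
    (Submodule.span_mono (Set.subset_insert y (Set.range fun k => wordOf (l k)))) (by omega)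
  rw [heq]
  exact Submodule.subset_span (Set.mem_insert _ _)

/-- The indices of the involutions that define the common eigenspace. -/
def usedIndices (r s p : ℕ) : Set (Fin p) := {k | LastOmitted r s → (k : ℕ) + 1 < p}

/-! ### Sign words, the volume word and duality -/

lemma weight_negMark : weight (negMark r s) = s := by
  simp [weight, negMark, ZMod.val_one]

lemma weight_one_add_negMark : weight (1 + negMark r s) = r := by
  simp only [weight, negMark, Fintype.sum_sum_type, Pi.add_apply, Pi.one_apply, Sum.elim_inl,
    Sum.elim_inr, add_zero, show (1 : ZMod 2) + 1 = 0 from rfl, ZMod.val_zero, ZMod.val_one]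
  simp

lemma weight_one : weight (1 : Fin r ⊕ Fin s → ZMod 2) = r + s := by
  simp [weight, ZMod.val_one]

lemma parity_negMark_self : parity (negMark r s) (negMark r s) = (s : ZMod 2) := by
  simp [parity_apply, negMark]

lemma parity_one : parity (negMark r s) 1 = (s : ZMod 2) := by
  simp [parity_apply, negMark]

lemma commForm_negMark (x : Fin r ⊕ Fin s → ZMod 2) :
    commForm (negMark r s) x = s * (∑ i, x i) + parity (negMark r s) x := by
  rw [commForm_apply, ← natCast_weight, weight_negMark]; rfl

lemma commForm_one (x : Fin r ⊕ Fin s → ZMod 2) :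
    commForm 1 x = ((r + s + 1 : ℕ) : ZMod 2) * (∑ i, x i) := by
  rw [commForm_apply, ← natCast_weight, weight_one]; push_cast; simp; ring

lemma commForm_one_add_negMark (x : Fin r ⊕ Fin s → ZMod 2) :
    commForm (1 + negMark r s) x =
      ((r + 2 * s + 1 : ℕ) : ZMod 2) * (∑ i, x i) + parity (negMark r s) x := by
  rw [map_add, LinearMap.add_apply, commForm_one, commForm_negMark]; push_cast; ring

/-- Finite-dimensional duality: if `K` vanished on the common kernel of the functionals `commForm (x
k)`, it would be a combination of them, hence of the form `commForm g`. -/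
lemma exists_word_of_dual {α : Type} [Finite α] {x : α → Fin r ⊕ Fin s → ZMod 2}
    {K : Module.Dual (ZMod 2) (Fin r ⊕ Fin s → ZMod 2)}
    (h : ∀ g ∈ Submodule.span (ZMod 2) (Set.range x), commForm g ≠ K) :
    ∃ y, (∀ k, commForm (x k) y = 0) ∧ K y = 1 := by
  by_contra! hcon
  have h1 : K ∈ Submodule.span (ZMod 2) (Set.range fun k => commForm (x k)) := by
    refine mem_span_of_iInf_ker_le_ker fun y hy => ?_
    rw [Submodule.mem_iInf] at hy
    exact (zmod_two_cases (K y)).resolve_right (hcon y fun k => hy k)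
  have h2 : (Set.range fun k => commForm (x k)) = commForm '' Set.range x := by
    rw [← Set.range_comp]; rfl
  rw [h2, ← Submodule.map_span] at h1
  obtain ⟨g, hg, rfl⟩ := h1
  exact h g hg rfl

lemma isSingular_one (hrs : LastOmitted r s) : IsSingular (negMark r s) 1 := by
  obtain ⟨h1, k, rfl⟩ := hrs
  refine ⟨Or.inr ?_, ?_⟩
  · rw [weight_one]; omega
  · rw [parity_one, ZMod.natCast_eq_zero_iff_even]; exact ⟨k, rfl⟩

lemma commForm_one_right (hrs : LastOmitted r s) (x : Fin r ⊕ Fin s → ZMod 2) :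
    commForm x 1 = 0 := by
  obtain ⟨h1, k, rfl⟩ := hrs
  rw [commForm_comm, commForm_one, (ZMod.natCast_eq_zero_iff_even).2, zero_mul]
  rw [Nat.even_iff]; omega

/-! ### Consequences of maximality of the span -/

namespace IsWordSystem

variable {P : Fin p → Cl r s} {l : Fin p → List (Fin r ⊕ Fin s)}

/-- By the ordering, a triple can only be the omitted last member, so the used words all have weight
four. -/
lemma sum_eq_zero_of_lastOmitted (h : IsWordSystem z P l) (hP : IsPI z P) (hrs : LastOmitted r s)
    {g : Fin r ⊕ Fin s → ZMod 2}
    (hg : g ∈ Submodule.span (ZMod 2) ((fun k => wordOf (l k)) '' usedIndices r s p)) :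
    ∑ i, g i = 0 := by
  induction hg using Submodule.span_induction with
  | mem _ hx =>
    obtain ⟨k, hk, rfl⟩ := hx
    have h4 : weight (wordOf (l k)) = 4 := by
      refine (h.weight_eq k).resolve_right fun h3 => ?_
      have := hP.ordered hrs k h3.2
      have := hk hrs
      omega
    simp only
    rw [← natCast_weight, h4]; rfl
  | zero => simp
  | add a b _ _ ha hb => simp [Finset.sum_add_distrib, ha, hb]
  | smul c a _ ha => simp [← Finset.mul_sum, ha]

lemma one_mem (h : IsWordSystem z P l) (hrs : LastOmitted r s) :
    (1 : Fin r ⊕ Fin s → ZMod 2) ∈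
      Submodule.span (ZMod 2) (Set.range fun k => wordOf (l k)) :=
  h.maximal.mem _ (isSingular_one hrs) fun x _ => commForm_one_right hrs x

/-- The radical of `commForm` contains at most the words 0 and 1. If the word 1 is radical and
singular, then r + s ≡ 3 modulo 4 with s even: precisely the exceptional case, where the used words
span only even words. -/
lemma eq_zero_of_mem_span_used (h : IsWordSystem z P l) (hP : IsPI z P)
    {g : Fin r ⊕ Fin s → ZMod 2}
    (hg : g ∈ Submodule.span (ZMod 2) ((fun k => wordOf (l k)) '' usedIndices r s p))
    (h0 : commForm g = 0) : g = 0 := by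
  have h1 : ∀ i, ∑ j, g j + g i = 0 := fun i => by
    rw [← commForm_single, commForm_comm, h0]; rfl
  rcases zmod_two_cases (∑ j, g j) with h2 | h2
  · ext i; simpa [h2] using h1 i
  · exfalso
    have hg1 : g = 1 := by
      ext i
      have := h1 i
      rw [h2] at this
      rcases zmod_two_cases (g i) with h3 | h3
      · rw [h3] at this; exact absurd this (by decide)
      · exact h3
    have hs := h.maximal.singular g (Submodule.span_mono (Set.image_subset_range _ _) hg)
    rw [hg1, IsSingular, weight_one, parity_one, ZMod.natCast_eq_zero_iff_even] at hs
    rw [hg1, ← natCast_weight, weight_one, ZMod.natCast_eq_one_iff_odd, Nat.odd_iff] at h2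
    have hrs : LastOmitted r s := by
      refine ⟨?_, hs.2⟩
      obtain ⟨k, hk⟩ := hs.2
      omega
    have := h.sum_eq_zero_of_lastOmitted hP hrs hg
    rw [hg1, ← natCast_weight, weight_one, ZMod.natCast_eq_zero_iff_even, Nat.even_iff] at this
    omega

/-- Exchange: the volume word is odd and the used words are even, so the omitted word must enter the
expansion of the volume word with coefficient one and can be replaced by it. -/
lemma span_le (h : IsWordSystem z P l) (hP : IsPI z P) (hrs : LastOmitted r s) :
    Submodule.span (ZMod 2) (Set.range fun k => wordOf (l k)) ≤
      Submodule.span (ZMod 2) (insert 1 ((fun k => wordOf (l k)) '' usedIndices r s p)) := by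
  have hmem : ∀ k ∈ usedIndices r s p, wordOf (l k) ∈
      Submodule.span (ZMod 2) (insert 1 ((fun k => wordOf (l k)) '' usedIndices r s p)) :=
    fun k hk => Submodule.subset_span (Set.mem_insert_of_mem _ ⟨k, hk, rfl⟩)
  have hodd : ∑ i, (1 : Fin r ⊕ Fin s → ZMod 2) i = 1 := by
    rw [← natCast_weight, weight_one, ZMod.natCast_eq_one_iff_odd, Nat.odd_iff]
    obtain ⟨h1, k, rfl⟩ := hrs
    omega
  rw [Submodule.span_le]
  rintro _ ⟨k, rfl⟩
  by_cases hk : k ∈ usedIndices r s p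
  · exact hmem k hk
  have hins : (1 : Fin r ⊕ Fin s → ZMod 2) ∈ Submodule.span (ZMod 2)
      (insert (wordOf (l k)) ((fun k => wordOf (l k)) '' usedIndices r s p)) := by
    refine Submodule.span_mono ?_ (h.one_mem hrs)
    rintro _ ⟨j, rfl⟩
    by_cases hj : j ∈ usedIndices r s p
    · exact Set.mem_insert_of_mem _ ⟨j, hj, rfl⟩
    · refine Set.mem_insert_iff.2 (Or.inl ?_)
      have : j = k := by
        simp only [usedIndices, Set.mem_ofPred_eq, not_forall] at hk hj
        have := hk.2
        have := hj.2
        omega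
      rw [this]
  obtain ⟨a, u, hu, hau⟩ := Submodule.mem_span_insert.1 hins
  have hu0 := h.sum_eq_zero_of_lastOmitted hP hrs hu
  rcases zmod_two_cases a with rfl | rfl
  · rw [zero_smul, zero_add] at hau
    rw [← hau, hodd] at hu0
    exact absurd hu0 one_ne_zero
  · rw [one_smul] at hau
    have : wordOf (l k) = 1 + u := by rw [hau, add_assoc, word_add_self, add_zero]
    simp only [SetLike.mem_coe]
    rw [this]
    exact add_mem (Submodule.subset_span (Set.mem_insert _ _))
      (Submodule.span_mono (Set.subset_insert _ _) hu)

/-- In the definite cases, all monomials commuting with the involutions are isometries. -/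
lemma parity_eq_zero (h : IsWordSystem z P l) (hrs : s % 4 = 0 ∨ r % 4 = 3)
    {y : Fin r ⊕ Fin s → ZMod 2} (hy : ∀ k, commForm (wordOf (l k)) y = 0) :
    parity (negMark r s) y = 0 := by
  have hyG : ∀ g ∈ Submodule.span (ZMod 2) (Set.range fun k => wordOf (l k)),
      commForm g y = 0 := fun g hg =>
    commForm_eq_zero_of_mem_span (by rintro _ ⟨k, rfl⟩; exact hy k) hg
  rcases hrs with hs | hr
  · have hs0 : (s : ZMod 2) = 0 := by
      rw [ZMod.natCast_eq_zero_iff_even, Nat.even_iff]; omega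
    have hc : ∀ x, commForm (negMark r s) x = parity (negMark r s) x := by
      intro x; rw [commForm_negMark, hs0, zero_mul, zero_add]
    rw [← hc]
    -- The word of all negative letters represents the parity functional and is singular because 4
    -- divides `s`. It commutes with the span, whose words have even parity, so maximality puts it
    -- there.
    refine hyG _ (h.maximal.mem _ ⟨?_, ?_⟩ fun x hx => ?_)
    · rw [weight_negMark]; exact Or.inl hs
    · rw [parity_negMark_self, hs0]
    · rw [commForm_comm, hc]; exact (h.maximal.singular x hx).2
  · have hr0 : ((r + 2 * s + 1 : ℕ) : ZMod 2) = 0 := by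
      rw [ZMod.natCast_eq_zero_iff_even, Nat.even_iff]; omega
    have hc : ∀ x, commForm (1 + negMark r s) x = parity (negMark r s) x := by
      intro x; rw [commForm_one_add_negMark, hr0, zero_mul, zero_add]
    rw [← hc]
    refine hyG _ (h.maximal.mem _ ⟨?_, ?_⟩ fun x hx => ?_)
    · rw [weight_one_add_negMark]; exact Or.inr hr
    · rw [map_add, parity_one, parity_negMark_self, CharTwo.add_self_eq_zero]
    · rw [commForm_comm, hc]; exact (h.maximal.singular x hx).2

/-- In the remaining cases, some monomial commuting with the involutions is an anti-isometry. -/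
lemma exists_parity_eq_one (h : IsWordSystem z P l) (hs : s % 4 ≠ 0) (hr : r % 4 ≠ 3) :
    ∃ y, (∀ k, commForm (wordOf (l k)) y = 0) ∧ parity (negMark r s) y = 1 := by
  refine exists_word_of_dual fun g hg hgK => ?_
  -- Evaluation on single letters determines g up to its parity: it marks all negative letters if
  -- even, all positive letters if odd. Singularity then contradicts the residues of s or r.
  have h1 : ∀ i, ∑ j, g j + g i = negMark r s i := fun i => by
    rw [← commForm_single, commForm_comm, hgK]; simp [parity_apply, Pi.single_apply]
  have hsing := (h.maximal.singular g hg)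
  rcases zmod_two_cases (∑ j, g j) with h2 | h2
  · have hg1 : g = negMark r s := by
      ext i; simpa [h2] using h1 i
    have h3 := hsing.1
    rw [hg1, weight_negMark] at h3
    rw [hg1, ← natCast_weight, weight_negMark, ZMod.natCast_eq_zero_iff_even, Nat.even_iff] at h2
    omega
  · have hg1 : g = 1 + negMark r s := by
      ext i
      rw [Pi.add_apply, ← h1 i, h2, Pi.one_apply, ← add_assoc, CharTwo.add_self_eq_zero, zero_add]
    have h3 := hsing.1
    rw [hg1, weight_one_add_negMark] at h3
    rw [hg1, ← natCast_weight, weight_one_add_negMark, ZMod.natCast_eq_one_iff_odd,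
      Nat.odd_iff] at h2
    omega

end IsWordSystem

end Families

/-! ### The action of monomials on admissible modules -/

section Action

variable {r s : ℕ} {z : Module.Basis (Fin r ⊕ Fin s) ℝ (RS r s)}
  {V : Type u} [AddCommGroup V] [Module ℝ V] {ρ : Cl r s →ₐ[ℝ] Module.End ℝ V}
  {B : LinearMap.BilinForm ℝ V}

lemma IsAdmissible.eq_of_forall (hB : IsAdmissible ρ B) {u v : V}
    (h : ∀ w, B u w = B v w) : u = v := by
  refine sub_eq_zero.1 (hB.nondegenerate.1 _ fun w => ?_)
  rw [map_sub, LinearMap.sub_apply, h, sub_self]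

lemma IsAdmissible.gen_gen (hz : IsOrthonormalBasis z) (hB : IsAdmissible ρ B)
    (i : Fin r ⊕ Fin s) (u v : V) :
    B (ρ (gen (z i)) u) (ρ (gen (z i)) v) = sgn (negMark r s i) * B u v := by
  have h1 := hB.skew (z i) u (ρ (gen (z i)) v)
  rw [← Module.End.mul_apply, ← map_mul, gen_mul_self hz, map_smul, map_one,
    LinearMap.smul_apply, Module.End.one_apply, map_smul, smul_eq_mul, basisSign_eq] at h1
  linarith

lemma IsAdmissible.monomial_monomial (hz : IsOrthonormalBasis z) (hB : IsAdmissible ρ B)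
    (l : List (Fin r ⊕ Fin s)) (u v : V) :
    B (ρ (monomial z l) u) (ρ (monomial z l) v) =
      sgn (parity (negMark r s) (wordOf l)) * B u v := by
  induction l with
  | nil => simp
  | cons i t ih =>
    have h : parity (negMark r s) (Pi.single i 1) = negMark r s i := by
      simp [parity_apply, Pi.single_apply]
    rw [monomial_cons, map_mul, Module.End.mul_apply, Module.End.mul_apply, hB.gen_gen hz, ih,
      wordOf_cons, map_add, sgn_add, h, mul_assoc]

/-- The sign of the adjoint of a monomial with `k` letters. -/
def adjointSign (k : ℕ) : ℝ := if k % 4 = 0 ∨ k % 4 = 3 then 1 else -1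

lemma adjointSign_succ (k : ℕ) : adjointSign (k + 1) = -(adjointSign k * sgn (k : ZMod 2)) := by
  rcases Nat.even_or_odd k with h | h
  · rw [(ZMod.natCast_eq_zero_iff_even).2 h, sgn_zero]
    rw [Nat.even_iff] at h
    have : k % 4 = 0 ∨ k % 4 = 2 := by omega
    rcases this with h | h <;> simp [adjointSign, Nat.add_mod, h]
  · rw [(ZMod.natCast_eq_one_iff_odd).2 h, sgn_one]
    rw [Nat.odd_iff] at h
    have : k % 4 = 1 ∨ k % 4 = 3 := by omega
    rcases this with h | h <;> simp [adjointSign, Nat.add_mod, h]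

/-- The adjoint of a product of k skew factors is (-1)^k times the reversed product, and reversal of
anticommuting factors gives (-1)^(k(k-1)/2). Peeling off one letter at a time produces the combined
sign. -/
lemma IsAdmissible.monomial_adjoint (hz : IsOrthonormalBasis z) (hB : IsAdmissible ρ B)
    {l : List (Fin r ⊕ Fin s)} (hl : l.Nodup) (u v : V) :
    B (ρ (monomial z l) u) v = adjointSign l.length * B u (ρ (monomial z l) v) := by
  induction l generalizing u v with
  | nil => simp [adjointSign]
  | cons i t ih =>
    rw [List.nodup_cons] at hl
    have h1 : commForm (Pi.single i 1) (wordOf t) = (t.length : ZMod 2) := by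
      rw [commForm_single, wordOf_apply_of_notMem hl.1, add_zero, ← natCast_weight,
        weight_wordOf hl.2]
    have h2 := gen_mul_monomial hz i t
    rw [h1] at h2
    have h3 := hB.skew (z i) (ρ (monomial z t) u) v
    rw [ih hl.2, ← Module.End.mul_apply, ← map_mul] at h3
    have h4 : ρ (monomial z t * gen (z i)) v =
        sgn (t.length : ZMod 2) • ρ (monomial z (i :: t)) v := by
      rw [monomial_cons, h2, map_smul, LinearMap.smul_apply, smul_smul, sgn_mul_self, one_smul]
    rw [← Module.End.mul_apply, ← map_mul, ← monomial_cons, h4, map_smul, smul_eq_mul] at h3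
    rw [List.length_cons, adjointSign_succ]
    linarith

/-- The action of the monomial of a word. -/
def act (ρ : Cl r s →ₐ[ℝ] Module.End ℝ V) (z : Module.Basis (Fin r ⊕ Fin s) ℝ (RS r s))
    (x : Fin r ⊕ Fin s → ZMod 2) : Module.End ℝ V := ρ (monomial z (letters x))

lemma monomial_apply_eq (hz : IsOrthonormalBasis z) (ρ : Cl r s →ₐ[ℝ] Module.End ℝ V)
    (l : List (Fin r ⊕ Fin s)) :
    ∃ c : ℝ, (c = 1 ∨ c = -1) ∧ ∀ v, ρ (monomial z l) v = c • act ρ z (wordOf l) v := by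
  rcases monomial_eq_or_eq_neg hz (wordOf_letters (wordOf l)).symm with h | h
  · exact ⟨1, Or.inl rfl, fun v => by rw [h, one_smul]; rfl⟩
  · exact ⟨-1, Or.inr rfl, fun v => by rw [h, map_neg, neg_one_smul]; rfl⟩

lemma act_add (hz : IsOrthonormalBasis z) (ρ : Cl r s →ₐ[ℝ] Module.End ℝ V)
    (x y : Fin r ⊕ Fin s → ZMod 2) :
    ∃ c : ℝ, (c = 1 ∨ c = -1) ∧ ∀ v, act ρ z (x + y) v = c • act ρ z x (act ρ z y v) := by
  obtain ⟨c, hc, h⟩ := monomial_apply_eq hz ρ (letters x ++ letters y)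
  refine ⟨c, hc, fun v => ?_⟩
  have h1 := h v
  rw [wordOf_append, wordOf_letters, wordOf_letters, monomial_append, map_mul,
    Module.End.mul_apply] at h1
  have h2 : c * c = 1 := by rcases hc with rfl | rfl <;> norm_num
  change act ρ z x (act ρ z y v) = c • act ρ z (x + y) v at h1
  rw [h1, smul_smul, h2, one_smul]

lemma act_zero (hz : IsOrthonormalBasis z) (ρ : Cl r s →ₐ[ℝ] Module.End ℝ V) :
    ∃ c : ℝ, (c = 1 ∨ c = -1) ∧ ∀ v, act ρ z 0 v = c • v := by
  obtain ⟨c, hc, h⟩ := monomial_apply_eq hz ρ []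
  refine ⟨c, hc, fun v => ?_⟩
  have h1 := h v
  have h2 : c * c = 1 := by rcases hc with rfl | rfl <;> norm_num
  rw [monomial_nil, map_one, Module.End.one_apply, wordOf_nil] at h1
  conv_rhs => rw [h1, smul_smul, h2, one_smul]

lemma act_comm (hz : IsOrthonormalBasis z) (ρ : Cl r s →ₐ[ℝ] Module.End ℝ V)
    (x y : Fin r ⊕ Fin s → ZMod 2) (v : V) :
    act ρ z x (act ρ z y v) = sgn (commForm x y) • act ρ z y (act ρ z x v) := by
  have := monomial_mul_monomial hz (letters x) (letters y)
  rw [wordOf_letters, wordOf_letters] at this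
  rw [act, act, ← Module.End.mul_apply, ← map_mul, this, map_smul, map_mul]; rfl

lemma gen_act_comm (hz : IsOrthonormalBasis z) (ρ : Cl r s →ₐ[ℝ] Module.End ℝ V)
    (i : Fin r ⊕ Fin s) (y : Fin r ⊕ Fin s → ZMod 2) (v : V) :
    ρ (gen (z i)) (act ρ z y v) =
      sgn (commForm (Pi.single i 1) y) • act ρ z y (ρ (gen (z i)) v) := by
  have := gen_mul_monomial hz i (letters y)
  rw [wordOf_letters] at this
  rw [act, ← Module.End.mul_apply, ← map_mul, this, map_smul, map_mul]; rfl

lemma IsAdmissible.act_act (hz : IsOrthonormalBasis z) (hB : IsAdmissible ρ B)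
    (x : Fin r ⊕ Fin s → ZMod 2) (u v : V) :
    B (act ρ z x u) (act ρ z x v) = sgn (parity (negMark r s) x) * B u v := by
  rw [act, hB.monomial_monomial hz, wordOf_letters]

lemma IsAdmissible.act_symm (hz : IsOrthonormalBasis z) (hB : IsAdmissible ρ B)
    {x : Fin r ⊕ Fin s → ZMod 2} (hx : weight x % 4 = 0 ∨ weight x % 4 = 3) (u v : V) :
    B (act ρ z x u) v = B u (act ρ z x v) := by
  rw [act, hB.monomial_adjoint hz (nodup_letters x), length_letters, adjointSign, if_pos hx,
    one_mul]

lemma IsAdmissible.act_skew (hz : IsOrthonormalBasis z) (hB : IsAdmissible ρ B)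
    {x : Fin r ⊕ Fin s → ZMod 2} (hx : ¬ (weight x % 4 = 0 ∨ weight x % 4 = 3)) (u : V) :
    B u (act ρ z x u) = 0 := by
  have h := hB.monomial_adjoint hz (nodup_letters x) u u
  rw [length_letters, adjointSign, if_neg hx, hB.symm] at h
  change B u (act ρ z x u) = -1 * B u (act ρ z x u) at h
  linarith

/-- A symmetric isometry of a nondegenerate form is its own inverse. -/
lemma IsAdmissible.act_act_self (hz : IsOrthonormalBasis z) (hB : IsAdmissible ρ B)
    {x : Fin r ⊕ Fin s → ZMod 2} (hx : IsSingular (negMark r s) x) (v : V) :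
    act ρ z x (act ρ z x v) = v := by
  refine hB.eq_of_forall fun w => ?_
  rw [hB.act_symm hz hx.1, hB.act_act hz, hx.2, sgn_zero, one_mul]

/-- Common eigenvectors are orthogonal to their images under anticommuting monomials. -/
lemma IsAdmissible.apply_act_eq_zero (hz : IsOrthonormalBasis z) (hB : IsAdmissible ρ B)
    {g y : Fin r ⊕ Fin s → ZMod 2} (hg : IsSingular (negMark r s) g)
    (hgy : commForm g y ≠ 0) {c : ℝ} (hc : c = 1 ∨ c = -1) {u v : V}
    (hu : act ρ z g u = c • u) (hv : act ρ z g v = c • v) : B u (act ρ z y v) = 0 := by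
  have h := hB.act_act hz g u (act ρ z y v)
  rw [act_comm hz, hu, hv, hg.2, (zmod_two_cases _).resolve_left hgy, sgn_one, sgn_zero] at h
  simp only [map_smul, LinearMap.smul_apply, smul_eq_mul] at h
  rcases hc with rfl | rfl <;> linarith

/-! ### Minimality -/

lemma invariant_of_basis {W : Submodule ℝ V} (hW : ∀ i, ∀ v ∈ W, ρ (gen (z i)) v ∈ W)
    (a : Cl r s) : ∀ v ∈ W, ρ a v ∈ W := by
  induction a using CliffordAlgebra.induction with
  | algebraMap c =>
    intro v hv
    rw [AlgHom.commutes, Module.algebraMap_end_apply]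
    exact W.smul_mem c hv
  | ι m =>
    intro v hv
    rw [← z.sum_repr m]
    simp only [map_sum, map_smul, LinearMap.sum_apply, LinearMap.smul_apply]
    exact W.sum_mem fun i _ => W.smul_mem _ (hW i v hv)
  | mul a b ha hb =>
    intro v hv
    rw [map_mul]
    exact ha _ (hb v hv)
  | add a b ha hb =>
    intro v hv
    rw [map_add]
    exact W.add_mem (ha v hv) (hb v hv)

/-- The restriction of a Clifford module structure to an invariant subspace. -/
def restrictModule (ρ : Cl r s →ₐ[ℝ] Module.End ℝ V) (W : Submodule ℝ V)
    (hW : ∀ a, ∀ v ∈ W, ρ a v ∈ W) : Cl r s →ₐ[ℝ] Module.End ℝ W where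
  toFun a := (ρ a).restrict (hW a)
  map_one' := by ext; simp
  map_mul' a b := by ext; simp
  map_zero' := by ext; simp
  map_add' a b := by ext; simp
  commutes' c := by ext; simp

/-- A nonzero invariant subspace with nondegenerate restriction is an admissible module, so
minimality leaves it no smaller dimension. This is the only way in which minimality is used. -/
lemma IsMinimalAdmissible.eq_top (hV : IsMinimalAdmissible ρ B) {W : Submodule ℝ V}
    (hW : W ≠ ⊥) (hinv : ∀ i, ∀ v ∈ W, ρ (gen (z i)) v ∈ W)
    (hnd : ∀ v ∈ W, (∀ w ∈ W, B v w = 0) → v = 0) : W = ⊤ := by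
  have := hV.finite
  have : Nontrivial W := Submodule.nontrivial_iff_ne_bot.2 hW
  have hadm : IsAdmissible (restrictModule ρ W (invariant_of_basis hinv)) (B.restrict W) := by
    refine ⟨fun x y => hV.admissible.symm x y, ⟨fun x hx => ?_, fun x hx => ?_⟩,
      fun m x y => hV.admissible.skew m x y⟩
    · exact Subtype.ext (hnd x x.2 fun w hw => hx ⟨w, hw⟩)
    · refine Subtype.ext (hnd x x.2 fun w hw => ?_)
      rw [hV.admissible.symm]
      exact hx ⟨w, hw⟩
  exact Submodule.eq_top_of_finrank_eq
    (le_antisymm (Submodule.finrank_le W) (hV.minimal W _ _ hadm))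

/-- A central symmetric involution acts on a minimal admissible module as a scalar. -/
lemma IsMinimalAdmissible.act_central (hz : IsOrthonormalBasis z)
    (hV : IsMinimalAdmissible ρ B) {g : Fin r ⊕ Fin s → ZMod 2}
    (hg : IsSingular (negMark r s) g) (hc : ∀ i, commForm (Pi.single i 1) g = 0) :
    ∃ c : ℝ, (c = 1 ∨ c = -1) ∧ ∀ v, act ρ z g v = c • v := by
  have hB := hV.admissible
  let W : Submodule ℝ V := LinearMap.ker (act ρ z g - 1)
  have hmem : ∀ v, v ∈ W ↔ act ρ z g v = v := fun v => by
    rw [LinearMap.mem_ker, LinearMap.sub_apply, Module.End.one_apply, sub_eq_zero]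
  have hproj : ∀ v, v + act ρ z g v ∈ W := fun v => by
    rw [hmem, map_add, hB.act_act_self hz hg, add_comm]
  -- The fixed space is invariant because the word is central, and nondegenerate because the
  -- projection onto it is symmetric; hence it is zero or everything.
  by_cases hW : W = ⊥
  · refine ⟨-1, Or.inr rfl, fun v => ?_⟩
    have := hproj v
    rw [hW, Submodule.mem_bot] at this
    rw [neg_one_smul, eq_neg_iff_add_eq_zero, add_comm, this]
  · have htop : W = ⊤ := by
      refine hV.eq_top (z := z) hW (fun i v hv => ?_) fun v hv h => ?_
      · rw [hmem] at hv ⊢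
        have := gen_act_comm hz ρ i g v
        rw [hc, sgn_zero, one_smul, hv] at this
        exact this.symm
      · refine hB.eq_of_forall fun w => ?_
        have h1 := h _ (hproj w)
        rw [map_add, ← hB.act_symm hz hg.1, (hmem v).1 hv] at h1
        rw [map_zero, LinearMap.zero_apply]
        linarith
    refine ⟨1, Or.inl rfl, fun v => ?_⟩
    rw [one_smul, ← hmem, htop]
    exact Submodule.mem_top

/-! ### Common eigenvectors -/

variable {α : Type} {x : α → Fin r ⊕ Fin s → ZMod 2} {η : α → ℝ}

/-- The vectors that are eigenvectors for the monomials of the words `x k`, `k ∈ S`. -/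
def jointEigenspace (ρ : Cl r s →ₐ[ℝ] Module.End ℝ V)
    (z : Module.Basis (Fin r ⊕ Fin s) ℝ (RS r s)) (x : α → Fin r ⊕ Fin s → ZMod 2) (η : α → ℝ)
    (S : Set α) : Submodule ℝ V := ⨅ k ∈ S, Module.End.eigenspace (act ρ z (x k)) (η k)

lemma mem_jointEigenspace {S : Set α} {v : V} :
    v ∈ jointEigenspace ρ z x η S ↔ ∀ k ∈ S, act ρ z (x k) v = η k • v := by
  simp only [jointEigenspace, Submodule.mem_iInf, Module.End.mem_eigenspace_iff]

lemma act_mem_jointEigenspace (hz : IsOrthonormalBasis z) {S : Set α} {y : Fin r ⊕ Fin s → ZMod 2}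
    (hy : ∀ k ∈ S, commForm (x k) y = 0) {v : V} (hv : v ∈ jointEigenspace ρ z x η S) :
    act ρ z y v ∈ jointEigenspace ρ z x η S := by
  rw [mem_jointEigenspace] at hv ⊢
  intro k hk
  rw [act_comm hz, hy k hk, sgn_zero, one_smul, hv k hk, map_smul]

/-- Twice the eigenprojection of the involution indexed by `k`; it preserves the other eigenvalues
because the involutions commute. -/
lemma add_act_mem_jointEigenspace (hz : IsOrthonormalBasis z) (hB : IsAdmissible ρ B)
    (hx : ∀ k, IsSingular (negMark r s) (x k)) (hxx : ∀ j k, commForm (x j) (x k) = 0)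
    (hη : ∀ k, η k = 1 ∨ η k = -1) {S : Set α} {k : α} {v : V}
    (hv : v ∈ jointEigenspace ρ z x η S) :
    v + η k • act ρ z (x k) v ∈ jointEigenspace ρ z x η (insert k S) := by
  have h1 := Submodule.add_mem _ hv (Submodule.smul_mem _ (η k)
    (act_mem_jointEigenspace hz (fun j _ => hxx j k) hv))
  rw [mem_jointEigenspace] at h1 ⊢
  rintro j (rfl | hj)
  · have h2 : η j * η j = 1 := by rcases hη j with h | h <;> rw [h] <;> norm_num
    rw [map_add, map_smul, hB.act_act_self hz (hx j), smul_add, smul_smul, h2, one_smul, add_comm]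
  · exact h1 j hj

/-- Eigenprojections of symmetric involutions are symmetric, so pairing an eigenvector with the
unnormalised projection of `w` gives twice its pairing with `w`. Nondegeneracy thus survives each
added condition. -/
lemma eq_zero_of_jointEigenspace (hz : IsOrthonormalBasis z) (hB : IsAdmissible ρ B)
    (hx : ∀ k, IsSingular (negMark r s) (x k)) (hxx : ∀ j k, commForm (x j) (x k) = 0)
    (hη : ∀ k, η k = 1 ∨ η k = -1) {S : Set α} (hS : S.Finite) :
    ∀ v ∈ jointEigenspace ρ z x η S,
      (∀ w ∈ jointEigenspace ρ z x η S, B v w = 0) → v = 0 := by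
  induction S, hS using Set.Finite.induction_on with
  | empty =>
    intro v _ h
    exact hB.nondegenerate.1 v fun w => h w (mem_jointEigenspace.2 (by simp))
  | @insert k S _ _ ih =>
    intro v hv h
    rw [mem_jointEigenspace] at hv
    refine ih v (mem_jointEigenspace.2 fun j hj => hv j (Set.mem_insert_of_mem _ hj))
      fun w hw => ?_
    have h2 : η k * η k = 1 := by rcases hη k with h | h <;> rw [h] <;> norm_num
    have h1 := h _ (add_act_mem_jointEigenspace hz hB hx hxx hη (k := k) hw)
    rw [map_add, map_smul, ← hB.act_symm hz (hx k).1, hv k (Set.mem_insert _ _), map_smul,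
      LinearMap.smul_apply, smul_smul, h2, one_smul] at h1
    linarith

/-- If the projection of `v` to the wanted eigenspace vanishes, then `v` has the opposite
eigenvalue, and a monomial commuting with the earlier involutions but anticommuting with the new one
moves it across. Without such a monomial the new word would differ from a combination of earlier
ones by a radical word, zero by `hS`, against independence. -/
lemma jointEigenspace_ne_bot [Nontrivial V] [Finite α] (hz : IsOrthonormalBasis z)
    (hB : IsAdmissible ρ B)
    (hx : ∀ k, IsSingular (negMark r s) (x k)) (hxx : ∀ j k, commForm (x j) (x k) = 0)
    (hη : ∀ k, η k = 1 ∨ η k = -1) (hi : LinearIndependent (ZMod 2) x) {S : Set α}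
    (hS : ∀ g ∈ Submodule.span (ZMod 2) (x '' S), commForm g = 0 → g = 0) :
    jointEigenspace ρ z x η S ≠ ⊥ := by
  induction S, S.toFinite using Set.Finite.induction_on with
  | empty =>
    obtain ⟨v, hv⟩ := exists_ne (0 : V)
    exact fun h => hv ((Submodule.mem_bot ℝ).1 (h ▸ mem_jointEigenspace.2 (by simp)))
  | @insert k S hk _ ih =>
    have hmono := Submodule.span_mono (R := ZMod 2) (Set.image_mono (f := x) (Set.subset_insert k S))
    obtain ⟨v, hv, hv0⟩ := (Submodule.ne_bot_iff _).1 (ih fun g hg => hS g (hmono hg))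
    rw [Submodule.ne_bot_iff]
    by_cases h0 : v + η k • act ρ z (x k) v = 0
    · obtain ⟨y, hy, hky⟩ : ∃ y, (∀ j : S, commForm (x j) y = 0) ∧ commForm (x k) y = 1 := by
        refine exists_word_of_dual fun g hg hgk => ?_
        have hr : Set.range (fun j : S => x j) = x '' S := by
          rw [Set.image_eq_range]
        rw [hr] at hg
        have h1 : g + x k = 0 := by
          refine hS _ (add_mem (hmono hg) (Submodule.subset_span ⟨k, Set.mem_insert _ _, rfl⟩)) ?_
          rw [map_add, hgk]
          exact LinearMap.ext fun a => CharTwo.add_self_eq_zero _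
        rw [linearIndependent_iff_notMem_span] at hi
        refine hi k ?_
        rw [← word_eq_of_add_eq_zero h1]
        have hsub : S ⊆ Set.univ \ {k} := fun j hj => ⟨trivial, fun h => hk (h ▸ hj)⟩
        exact Submodule.span_mono (Set.image_mono hsub) hg
      refine ⟨act ρ z y v, mem_jointEigenspace.2 ?_, fun h => ?_⟩
      · rintro j (rfl | hj)
        · have h2 : η j * η j = 1 := by rcases hη j with h | h <;> rw [h] <;> norm_num
          have h3 : act ρ z (x j) v = -(η j • v) := by
            have := congrArg (fun u => η j • u) h0
            simp only [smul_add, smul_smul, h2, one_smul, smul_zero] at this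
            rw [eq_neg_iff_add_eq_zero, add_comm, this]
          rw [act_comm hz, hky, sgn_one, h3, map_neg, map_smul, neg_one_smul, neg_neg]
        · exact mem_jointEigenspace.1
            (act_mem_jointEigenspace hz (fun j hj => hy ⟨j, hj⟩) hv) j hj
      · refine hv0 (hB.eq_of_forall fun w => ?_)
        have := hB.act_act hz y v w
        rw [h, map_zero, LinearMap.zero_apply] at this
        rw [map_zero, LinearMap.zero_apply]
        rcases sgn_cases (parity (negMark r s) y) with h2 | h2 <;> rw [h2] at this <;> linarith
    · exact ⟨_, add_act_mem_jointEigenspace hz hB hx hxx hη hv, h0⟩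

/-- If the monomials of some words act on a subspace as scalars `±1`, then so do their products. -/
lemma exists_scalar_of_mem_span (hz : IsOrthonormalBasis z) {X : Set (Fin r ⊕ Fin s → ZMod 2)}
    {E : Submodule ℝ V}
    (hX : ∀ g ∈ X, ∃ c : ℝ, (c = 1 ∨ c = -1) ∧ ∀ v ∈ E, act ρ z g v = c • v)
    {g : Fin r ⊕ Fin s → ZMod 2} (hg : g ∈ Submodule.span (ZMod 2) X) :
    ∃ c : ℝ, (c = 1 ∨ c = -1) ∧ ∀ v ∈ E, act ρ z g v = c • v := by
  have hzero : ∃ c : ℝ, (c = 1 ∨ c = -1) ∧ ∀ v ∈ E, act ρ z 0 v = c • v := by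
    obtain ⟨c, hc, h⟩ := act_zero hz ρ
    exact ⟨c, hc, fun v _ => h v⟩
  induction hg using Submodule.span_induction with
  | mem g hg => exact hX g hg
  | zero => exact hzero
  | add a b _ _ ha hb =>
    obtain ⟨c, hc, h⟩ := ha
    obtain ⟨d, hd, h'⟩ := hb
    obtain ⟨e, he, h''⟩ := act_add hz ρ a b
    refine ⟨e * (d * c), ?_, fun v hv => ?_⟩
    · rcases hc with rfl | rfl <;> rcases hd with rfl | rfl <;> rcases he with rfl | rfl <;> simp
    · rw [h'', h' v hv, map_smul, h v hv, smul_smul, smul_smul, mul_assoc]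
  | smul c a _ ha =>
    rcases zmod_two_cases c with rfl | rfl
    · rw [zero_smul]; exact hzero
    · rwa [one_smul]

end Action

/-! ### Neutral and definite restrictions -/

section Restriction

/-- By Sylvester's law the positive and negative indices are invariants, and equivalence with the
negative form interchanges them. The rest matches the two equal index sets with the summands of `Qrs
l l`. -/
lemma equivalent_Qrs_of_neg {M : Type*} [AddCommGroup M] [Module ℝ M] [FiniteDimensional ℝ M]
    (Q : QuadraticForm ℝ M) (hQ : (QuadraticMap.associated (R := ℝ) Q).SeparatingLeft)
    (hneg : Q.Equivalent (-Q)) : ∃ l : ℕ, Q.Equivalent (Qrs l l) := by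
  obtain ⟨w, hw, hQw⟩ := QuadraticForm.equivalent_one_neg_one_weighted_sum_squared Q hQ
  have h1 := QuadraticForm.sigPos_of_equiv_weightedSumSquares hQw
  have h2 := QuadraticForm.sigNeg_of_equiv_weightedSumSquares hQw
  have h3 := hneg.sigPos_eq
  rw [sigPos_neg, h1, h2] at h3
  have hcompl : {i | w i < 0} = {i | 0 < w i}ᶜ := by
    ext i
    rcases hw i with h | h <;> simp [h]
  let p : Fin (Module.finrank ℝ M) → Prop := fun i => 0 < w i
  let l := {i | 0 < w i}.ncard
  have c1 : Nat.card {i // p i} = l := rfl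
  have c2 : Nat.card {i // ¬ p i} = l := by
    change ({i | 0 < w i}ᶜ : Set _).ncard = l
    rw [← hcompl, ← h3]
  let e : Fin (Module.finrank ℝ M) ≃ Fin l ⊕ Fin l := by
    classical
    exact (Equiv.sumCompl p).symm.trans
      (Equiv.sumCongr (Finite.equivFinOfCardEq c1) (Finite.equivFinOfCardEq c2))
  have hwe : ∀ i, w (e.symm i) =
      (Sum.elim (fun _ => (1 : ℝ)) (fun _ => (-1 : ℝ)) : Fin l ⊕ Fin l → ℝ) i := by
    rintro (i | i)
    · have : p (e.symm (Sum.inl i)) := ((Finite.equivFinOfCardEq c1).symm i).2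
      rcases hw (e.symm (Sum.inl i)) with h | h
      · have := this.trans_eq h
        norm_num at this
      · simpa using h
    · have : ¬ p (e.symm (Sum.inr i)) := ((Finite.equivFinOfCardEq c2).symm i).2
      rcases hw (e.symm (Sum.inr i)) with h | h
      · simpa using h
      · exact absurd (show 0 < w (e.symm (Sum.inr i)) by rw [h]; exact one_pos) this
  refine ⟨l, hQw.trans ⟨⟨LinearEquiv.funCongrLeft ℝ ℝ e.symm, fun v => ?_⟩⟩⟩
  simp only [Qrs, QuadraticMap.weightedSumSquares_apply]
  rw [← Equiv.sum_comp e.symm]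
  refine Finset.sum_congr rfl fun i _ => ?_
  rw [← hwe]
  rfl

variable {r s : ℕ} {z : Module.Basis (Fin r ⊕ Fin s) ℝ (RS r s)}
  {V : Type u} [AddCommGroup V] [Module ℝ V] {ρ : Cl r s →ₐ[ℝ] Module.End ℝ V}
  {B : LinearMap.BilinForm ℝ V}

lemma isNeutralOn_of_antiIsometry [FiniteDimensional ℝ V] {E : Submodule ℝ V}
    (hs : ∀ x y, B x y = B y x) (hE : ∀ v ∈ E, (∀ w ∈ E, B v w = 0) → v = 0)
    (T : Module.End ℝ V) (hT : ∀ v ∈ E, T v ∈ E)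
    (hTT : ∀ u ∈ E, ∀ v ∈ E, B (T u) (T v) = -B u v) : IsNeutralOn B E := by
  refine equivalent_Qrs_of_neg _ ?_ ?_
  · rw [restrictedForm, QuadraticMap.associated_left_inverse ℝ fun x y : E => hs x y]
    exact fun v hv => Subtype.ext (hE v v.2 fun w hw => hv ⟨w, hw⟩)
  · have hinj : Function.Injective (T.restrict hT) := by
      rw [← LinearMap.ker_eq_bot, LinearMap.ker_eq_bot']
      intro v hv
      refine Subtype.ext (hE v v.2 fun w hw => ?_)
      have h1 := hTT v v.2 w hw
      have h2 : T v = 0 := congrArg Subtype.val hv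
      rw [h2, map_zero, LinearMap.zero_apply] at h1
      linarith
    refine ⟨⟨LinearEquiv.ofInjectiveEndo _ hinj, fun v => ?_⟩⟩
    change -B (T v) (T v) = B v v
    rw [hTT v v.2 v v.2, neg_neg]

/-! ### The frame operator and definiteness -/

variable {α : Type} {x : α → Fin r ⊕ Fin s → ZMod 2} {E : Submodule ℝ V}

lemma exists_apply_self_ne_zero (hs : ∀ x y, B x y = B y x)
    (hE : ∀ v ∈ E, (∀ w ∈ E, B v w = 0) → v = 0) (h0 : E ≠ ⊥) : ∃ v ∈ E, B v v ≠ 0 := by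
  by_contra! h
  obtain ⟨v, hv, hv0⟩ := (Submodule.ne_bot_iff _).1 h0
  refine hv0 (hE v hv fun w hw => ?_)
  have h1 := h _ (E.add_mem hv hw)
  simp only [map_add, LinearMap.add_apply, h v hv, h w hw, hs w v] at h1
  linarith

/-- The sum of the projections onto the images of `v` under all monomials. -/
def frame (ρ : Cl r s →ₐ[ℝ] Module.End ℝ V) (z : Module.Basis (Fin r ⊕ Fin s) ℝ (RS r s))
    (B : LinearMap.BilinForm ℝ V) (v : V) : Module.End ℝ V :=
  ∑ y, sgn (parity (negMark r s) y) • (B.flip (act ρ z y v)).smulRight (act ρ z y v)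

lemma frame_apply (v w : V) : frame ρ z B v w =
    ∑ y, (sgn (parity (negMark r s) y) * B w (act ρ z y v)) • act ρ z y v := by
  simp [frame, LinearMap.sum_apply, smul_smul]

/-- The sum runs over the whole group of words, so it can be shifted by `k`. The unknown sign from
`act_add` occurs twice and cancels, as does the isometry sign of `k`, thanks to the weights in
`frame`. -/
lemma frame_act (hz : IsOrthonormalBasis z) (hB : IsAdmissible ρ B)
    (k : Fin r ⊕ Fin s → ZMod 2) (v : V) :
    frame ρ z B v (act ρ z k v) = act ρ z k (frame ρ z B v v) := by
  rw [frame_apply, frame_apply, ← Equiv.sum_comp (Equiv.addLeft k), map_sum]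
  refine Finset.sum_congr rfl fun y _ => ?_
  obtain ⟨c, hc, h⟩ := act_add hz ρ k y
  rw [Equiv.coe_addLeft, h, map_add, sgn_add, map_smul, hB.act_act hz, map_smul, smul_smul,
    smul_eq_mul]
  congr 1
  have h1 : c * c = 1 := by rcases hc with rfl | rfl <;> norm_num
  have h2 := sgn_mul_self (parity (negMark r s) k)
  linear_combination (sgn (parity (negMark r s) y) * B v (act ρ z y v)) *
    ((sgn (parity (negMark r s) k) * sgn (parity (negMark r s) k)) * h1 + h2)

open scoped Classical in
theorem isSignDefiniteOn_of_maximal (hz : IsOrthonormalBasis z) (hV : IsMinimalAdmissible ρ B)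
    (hM : MaximalSingular (negMark r s) (Submodule.span (ZMod 2) (Set.range x)))
    (hpar : ∀ y, (∀ k, commForm (x k) y = 0) → parity (negMark r s) y = 0)
    (hnd : ∀ v ∈ E, (∀ w ∈ E, B v w = 0) → v = 0) (h0 : E ≠ ⊥)
    (hc : ∀ g ∈ Submodule.span (ZMod 2) (Set.range x),
      ∃ c : ℝ, (c = 1 ∨ c = -1) ∧ ∀ v ∈ E, act ρ z g v = c • v) :
    IsSignDefiniteOn B E := by
  have hB := hV.admissible
  obtain ⟨v, hv, hvv⟩ := exists_apply_self_ne_zero hB.symm hnd h0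
  have horth : ∀ y, (∃ k, commForm (x k) y ≠ 0) → ∀ u ∈ E, B u (act ρ z y v) = 0 := by
    rintro y ⟨k, hk⟩ u hu
    have hk' := Submodule.subset_span (R := ZMod 2) (Set.mem_range_self (f := x) k)
    obtain ⟨c, hc, h⟩ := hc _ hk'
    exact hB.apply_act_eq_zero hz (hM.singular _ hk') hk hc (h u hu) (h v hv)
  let M := Submodule.span (ZMod 2) (Set.range x)
  -- Words in M send v to ±v, and the sign squares away. Any other word contributes nothing: either
  -- it anticommutes with some involution, or it commutes with all of them, is an isometry by
  -- `hpar`, and then must be skew, since otherwise maximality would place it in M.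
  have hterm : ∀ y, (sgn (parity (negMark r s) y) * B v (act ρ z y v)) • act ρ z y v =
      (if y ∈ M then B v v else 0) • v := by
    intro y
    by_cases hy : y ∈ M
    · obtain ⟨c, hc, h⟩ := hc y hy
      rw [if_pos hy, (hM.singular y hy).2, h v hv, map_smul, sgn_zero, smul_smul, smul_eq_mul]
      rcases hc with rfl | rfl <;> simp
    · rw [if_neg hy, zero_smul]
      suffices B v (act ρ z y v) = 0 by rw [this, mul_zero, zero_smul]
      by_cases hk : ∃ k, commForm (x k) y ≠ 0
      · exact horth y hk v hv
      · push Not at hk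
        refine hB.act_skew hz (fun hw => hy ?_) v
        refine hM.mem y ⟨hw, hpar y hk⟩ fun g hg => ?_
        exact commForm_eq_zero_of_mem_span (by rintro _ ⟨k, rfl⟩; exact hk k) hg
  let m : ℝ := (Finset.univ.filter (· ∈ M)).card
  have hm : 0 < m := Nat.cast_pos.2 (Finset.card_pos.2 ⟨0, by simp⟩)
  have hframe : frame ρ z B v v = (m * B v v) • v := by
    rw [frame_apply, Finset.sum_congr rfl fun y _ => hterm y, ← Finset.sum_smul,
      ← Finset.sum_filter, Finset.sum_const, nsmul_eq_mul]
  have hmB : m * B v v ≠ 0 := mul_ne_zero hm.ne' hvv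
  let W : Submodule ℝ V := Submodule.span ℝ (Set.range fun y => act ρ z y v)
  have hWframe : ∀ w ∈ W, frame ρ z B v w = (m * B v v) • w := by
    intro w hw
    induction hw using Submodule.span_induction with
    | mem _ hw =>
      obtain ⟨k, rfl⟩ := hw
      simp only
      rw [frame_act hz hB, hframe, map_smul]
    | zero => simp
    | add a b _ _ ha hb => rw [map_add, ha, hb, smul_add]
    | smul c a _ ha => rw [map_smul, ha, smul_comm]
  -- On W the frame operator is a nonzero scalar but is built from exactly these pairings; this is
  -- nondegeneracy of W.
  have hzero : ∀ w ∈ W, (∀ y, B w (act ρ z y v) = 0) → w = 0 := by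
    intro w hw h
    have h1 := hWframe w hw
    rw [frame_apply] at h1
    simp only [h, mul_zero, zero_smul, Finset.sum_const_zero] at h1
    exact (smul_eq_zero.1 h1.symm).resolve_left hmB
  have hvW : v ∈ W := by
    have h1 : frame ρ z B v v ∈ W := by
      rw [frame_apply]
      exact W.sum_mem fun y _ => W.smul_mem _ (Submodule.subset_span ⟨y, rfl⟩)
    rw [hframe] at h1
    exact (W.smul_mem_iff hmB).1 h1
  have htop : W = ⊤ := by
    refine hV.eq_top (z := z) ?_ ?_ fun w hw h => ?_
    · refine (Submodule.ne_bot_iff _).2 ⟨v, hvW, ?_⟩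
      rintro rfl
      simp at hvv
    · intro i w hw
      induction hw using Submodule.span_induction with
      | mem _ hw =>
        obtain ⟨k, rfl⟩ := hw
        obtain ⟨c, -, h⟩ := monomial_apply_eq hz ρ (i :: letters k)
        have h1 := h v
        rw [monomial_cons, map_mul, Module.End.mul_apply] at h1
        change ρ (gen (z i)) (act ρ z k v) = _ at h1
        simp only
        rw [h1]
        exact W.smul_mem _ (Submodule.subset_span ⟨_, rfl⟩)
      | zero => simp
      | add a b _ _ ha hb => rw [map_add]; exact W.add_mem ha hb
      | smul c a _ ha => rw [map_smul]; exact W.smul_mem _ ha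
    · exact hzero w hw fun y => h _ (Submodule.subset_span ⟨y, rfl⟩)
  have hpos : ∀ u ∈ E, u ≠ 0 → 0 < B v v * B u u := by
    intro u hu hu0
    have huW : u ∈ W := htop ▸ Submodule.mem_top
    -- The pairing of u with its frame image, computed twice. Only words commuting with all the
    -- involutions contribute, and for them the weight in the frame sum is +1.
    have h1 : m * B v v * B u u = ∑ y, B u (act ρ z y v) ^ 2 := by
      have h2 := congrArg (B u) (hWframe u huW)
      rw [frame_apply, map_sum, map_smul, smul_eq_mul] at h2
      rw [← h2]
      refine Finset.sum_congr rfl fun y _ => ?_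
      rw [map_smul, smul_eq_mul]
      by_cases hk : ∃ k, commForm (x k) y ≠ 0
      · simp [horth y hk u hu]
      · push Not at hk
        rw [hpar y hk, sgn_zero]; ring
    have h3 : 0 < ∑ y, B u (act ρ z y v) ^ 2 := by
      refine lt_of_le_of_ne (Finset.sum_nonneg fun y _ => sq_nonneg _) fun h => hu0 ?_
      rw [eq_comm, Finset.sum_eq_zero_iff_of_nonneg fun y _ => sq_nonneg _] at h
      exact hzero u huW fun y => by simpa using h y (Finset.mem_univ y)
    rw [← h1, mul_assoc] at h3
    exact pos_of_mul_pos_right h3 hm.le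
  rcases lt_or_gt_of_ne hvv with h | h
  · refine Or.inr fun u hu => ?_
    have h1 := hpos u u.2 fun h => hu (Subtype.ext h)
    change 0 < -B u u
    nlinarith
  · refine Or.inl fun u hu => ?_
    have h1 := hpos u u.2 fun h => hu (Subtype.ext h)
    change 0 < B u u
    exact pos_of_mul_pos_right h1 h.le

end Restriction

end PseudoHType

end

open PseudoHType

theorem mainTheorem5 (r s : ℕ)
    (z : Module.Basis (Fin r ⊕ Fin s) ℝ (PseudoHType.RS r s))
    (hz : PseudoHType.IsOrthonormalBasis z)
    {V : Type u} [AddCommGroup V] [Module ℝ V]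
    (ρ : PseudoHType.Cl r s →ₐ[ℝ] Module.End ℝ V) (B : LinearMap.BilinForm ℝ V)
    (hV : PseudoHType.IsMinimalAdmissible ρ B)
    {p : ℕ} (P : Fin p → PseudoHType.Cl r s) (hP : PseudoHType.IsPI z P) :
    PseudoHType.commonEigenspace ρ P ≠ ⊥ ∧
    (((r % 4 = 0 ∨ r % 4 = 1 ∨ r % 4 = 2) ∧ s % 4 = 0 ∨ r % 4 = 3 →
        PseudoHType.IsSignDefiniteOn B (PseudoHType.commonEigenspace ρ P)) ∧
      (¬ ((r % 4 = 0 ∨ r % 4 = 1 ∨ r % 4 = 2) ∧ s % 4 = 0 ∨ r % 4 = 3) →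
        PseudoHType.IsNeutralOn B (PseudoHType.commonEigenspace ρ P))) := by
  have := hV.finite
  have := hV.nontrivial
  have hB := hV.admissible
  -- Acting on a nonzero module already makes the algebra nontrivial, which is all that is needed to
  -- tell monomials with different words apart.
  have : Nontrivial (Cl r s) := ρ.toRingHom.domain_nontrivial
  obtain ⟨l, hl⟩ := hP.exists_isWordSystem hz
  let x : Fin p → Fin r ⊕ Fin s → ZMod 2 := fun k => wordOf (l k)
  have hxmem : ∀ k, x k ∈ Submodule.span (ZMod 2) (Set.range x) := fun k =>
    Submodule.subset_span ⟨k, rfl⟩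
  have hx : ∀ k, IsSingular (negMark r s) (x k) := fun k => hl.maximal.singular _ (hxmem k)
  have hxx : ∀ j k, commForm (x j) (x k) = 0 := fun j k =>
    hl.maximal.isotropic _ (hxmem j) _ (hxmem k)
  -- The factors of each involution may come in an order other than that fixed by `letters`, so its
  -- 1-eigenspace is an eigenspace of `act` for the correcting sign `η k`.
  choose η hη hρ using fun k => monomial_apply_eq hz ρ (l k)
  have hηη : ∀ k, η k * η k = 1 := fun k => by rcases hη k with h | h <;> rw [h] <;> norm_num
  have hE : commonEigenspace ρ P = jointEigenspace ρ z x η (usedIndices r s p) := by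
    ext v
    rw [mem_jointEigenspace]
    simp only [commonEigenspace, Submodule.mem_iInf, Module.End.mem_eigenspace_iff]
    refine forall_congr' fun k => forall_congr' fun _ => ?_
    rw [hl.eq_monomial, hρ, one_smul]
    constructor
    · intro h
      rw [← h, smul_smul, hηη, one_smul, h]
    · intro h
      rw [h, smul_smul, hηη, one_smul]
  have hne : jointEigenspace ρ z x η (usedIndices r s p) ≠ ⊥ :=
    jointEigenspace_ne_bot hz hB hx hxx hη hl.linearIndependent
      fun g hg h => hl.eq_zero_of_mem_span_used hP hg h
  have hnd := eq_zero_of_jointEigenspace (S := usedIndices r s p) hz hB hx hxx hη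
    (Set.toFinite _)
  rw [hE]
  refine ⟨hne, fun hrs => ?_, fun hrs => ?_⟩
  · refine isSignDefiniteOn_of_maximal hz hV hl.maximal
      (fun y hy => hl.parity_eq_zero (by omega) hy) hnd hne fun g hg => ?_
    have hused : ∀ k ∈ usedIndices r s p, ∃ c : ℝ, (c = 1 ∨ c = -1) ∧
        ∀ v ∈ jointEigenspace ρ z x η (usedIndices r s p), act ρ z (x k) v = c • v :=
      fun k hk => ⟨η k, hη k, fun v hv => mem_jointEigenspace.1 hv k hk⟩
    -- The omitted involution imposes no condition on E, yet its word is the volume word plus used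
    -- words, and the volume word acts as a scalar by minimality.
    by_cases hlast : LastOmitted r s
    · refine exists_scalar_of_mem_span hz ?_ (hl.span_le hP hlast hg)
      rintro _ (rfl | ⟨k, hk, rfl⟩)
      · obtain ⟨c, hc, h⟩ := hV.act_central hz (isSingular_one hlast) fun i =>
          commForm_one_right hlast _
        exact ⟨c, hc, fun v _ => h v⟩
      · exact hused k hk
    · refine exists_scalar_of_mem_span hz ?_ hg
      rintro _ ⟨k, rfl⟩
      exact hused k fun h => absurd h hlast
  · obtain ⟨y, hy, hy1⟩ := hl.exists_parity_eq_one (by omega) (by omega)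
    refine isNeutralOn_of_antiIsometry hB.symm hnd (act ρ z y)
      (fun v hv => act_mem_jointEigenspace hz (fun k _ => hy k) hv) fun u _ v _ => ?_
    rw [hB.act_act hz, hy1, sgn_one, neg_one_mul]
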